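/- Let $X,Y$ be real Hilbert spaces, $K:X\to Y$ bounded and linear, $G:X\to\mathbb R\cup\{+\infty\}$ and $F^*:Y\to\mathbb R\cup\{+\infty\}$ proper, convex and lower semicontinuous, and $Q:X\to\mathbb R$, $P^*:Y\to\mathbb R$ convex and differentiable. Consider the saddle point problem $$\min_{x\in X}\max_{y\in Y}\; G(x)+Q(x)+\langle Kx,y\rangle-F^*(y)-P^*(y),$$ and assume that it has a saddle point. Let $T,D:X\to X$ and $\Sigma,E:Y\to Y$ be bounded, linear, selfadjoint, positive definite maps with bounded inverses, and let $\nabla Q$ and $\nabla P^*$ be co-coercive with respect to $D^{-1}$ and $E^{-1}$, that is, $$\langle \nabla Q(x)-\nabla Q(x'),x-x'\rangle\ge\langle D^{-1}(\nabla Q(x)-\nabla Q(x')),\nabla Q(x)-\nabla Q(x')\rangle\quad\text{for all }x,x'\in X,$$ and likewise for $\nabla P^*$ with $E^{-1}$. Let $(\alpha_k)_{k\ge0}$ be a nondecreasing sequence in $[0,\alpha]$ with $\alpha<1$, and let $(x^k,y^k)$ be generated, from arbitrary starting points $x^{-1},x^0\in X$, $y^{-1},y^0\in Y$, by $$\begin{cases}\xi^k=x^k+\alpha_k(x^k-x^{k-1})\\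 \zeta^k=y^k+\alpha_k(y^k-y^{k-1})\\ x^{k+1}=(\mathrm{id}+T\partial G)^{-1}\big(\xi^k-T(\nabla Q(\xi^k)+K^*\zeta^k)\big)\\ \bar\xi^{k+1}=2x^{k+1}-\xi^k\\ y^{k+1}=(\mathrm{id}+\Sigma\partial F^*)^{-1}\big(\zeta^k-\Sigma(\nabla P^*(\zeta^k)-K\bar\xi^{k+1})\big)\end{cases}\qquad(k\ge0).$$ Put $\|(x,y)\|_M^2=\langle T^{-1}x,x\rangle-2\langle Kx,y\rangle+\langle\Sigma^{-1}y,y\rangle$. Write $A>0$ if $A$ is selfadjoint, positive and boundedly invertible; $A\ge B$ is the usual order of selfadjoint operators; $A^{-1/2}$ is the positive square root of the bounded inverse of $A$, and a condition in which it occurs includes the requirement that it exists. (a) If $$\Sigma^{-1}-\tfrac12E>0,\qquad T^{-1}-\tfrac12D>0,\qquad \big\|(\Sigma^{-1}-\tfrac12E)^{-1/2}K(T^{-1}-\tfrac12D)^{-1/2}\big\|<1,$$ and $$\sum_{k=1}^\infty\alpha_k\|(x^k,y^k)-(x^{k-1},y^{k-1})\|_M^2<\infty,\qquad(*)$$ then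 $(x^k,y^k)$ converges weakly to a saddle point. (b) If there is an $\varepsilon>0$ such that for all $k$ $$(1-3\alpha_k-\varepsilon)\Sigma^{-1}\ge\tfrac{(1-\alpha_k)^2}2E,\qquad(1-3\alpha_k-\varepsilon)T^{-1}\ge\tfrac{(1-\alpha_k)^2}2D,$$ $$\Big\|\Big((1-3\alpha_k-\varepsilon)\Sigma^{-1}-\tfrac{(1-\alpha_k)^2}2E\Big)^{-1/2}K\Big((1-3\alpha_k-\varepsilon)T^{-1}-\tfrac{(1-\alpha_k)^2}2D\Big)^{-1/2}\Big\|\le\frac1{1-3\alpha_k-\varepsilon},$$ then $(*)$ holds, and $(x^k,y^k)$ converges weakly to a saddle point. -/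

import Mathlib

open Filter Topology

namespace InertialPD

noncomputable section

section Functions

variable {H : Type*} [NormedAddCommGroup H] [InnerProductSpace ℝ H]

/-- `f : H → ℝ ∪ {+∞}` is proper, convex (its epigraph is convex) and lower semicontinuous. -/
structure IsProperConvexLsc (f : H → EReal) : Prop where
  ne_bot : ∀ x, f x ≠ ⊥
  proper : ∃ x, f x ≠ ⊤
  convex : Convex ℝ {p : H × ℝ | f p.1 ≤ (p.2 : EReal)}
  lsc : LowerSemicontinuous f

/-- The convex subdifferential `∂f(x) = {p | f(z) ≥ f(x) + ⟨p, z - x⟩ for all z}`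
(which is empty at points where `f = +∞`, if `f` is proper). -/
def subdifferential (f : H → EReal) (x : H) : Set H :=
  {p | ∀ z, f x + ((inner ℝ p (z - x) : ℝ) : EReal) ≤ f z}

/-- The (set-valued) resolvent `(id + S A)⁻¹(u)` of `S A`, for a set-valued map `A`
and a linear map `S`. -/
def setResolvent (S : H →L[ℝ] H) (A : H → Set H) (u : H) : Set H :=
  {x | ∃ p ∈ A x, x + S p = u}

/-- `B` is co-coercive with respect to the linear map `C`:
`⟨B x - B y, x - y⟩ ≥ ‖B x - B y‖²_C`, where `‖v‖²_C = ⟨C v, v⟩`. -/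
def IsCocoerciveWrt (B : H → H) (C : H →L[ℝ] H) : Prop :=
  ∀ x y, inner ℝ (C (B x - B y)) (B x - B y) ≤ inner ℝ (B x - B y) (x - y)

/-- `R = A^{-1/2}`: `R` is the positive square root of the bounded inverse of `A`.
(Every positive, boundedly invertible `A` has exactly one such `R`, and no other positive
`A` has one.) -/
structure IsInvSqrt (A R : H →L[ℝ] H) : Prop where
  pos : R.IsPositive
  mul_left : R * R * A = 1
  mul_right : A * (R * R) = 1

end Functions

variable {X Y : Type*} [NormedAddCommGroup X] [InnerProductSpace ℝ X] [CompleteSpace X]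
  [NormedAddCommGroup Y] [InnerProductSpace ℝ Y] [CompleteSpace Y]

/-- The saddle function `G(x) + Q(x) + ⟨K x, y⟩ - F*(y) - P*(y)`;
`Fs`, `Ps` stand for `F*`, `P*`. -/
def saddleFun (G : X → EReal) (Q : X → ℝ) (Fs : Y → EReal) (Ps : Y → ℝ) (K : X →L[ℝ] Y)
    (x : X) (y : Y) : EReal :=
  G x + (Q x : EReal) + ((inner ℝ (K x) y : ℝ) : EReal) - Fs y - (Ps y : EReal)

/-- `(xs, ys)` is a saddle point of `min_x max_y saddleFun x y`. Since `xs` and `ys` lie in the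
domains of `G` and `Fs`, no difference `∞ - ∞` occurs in the inequalities. -/
structure IsSaddlePoint (G : X → EReal) (Q : X → ℝ) (Fs : Y → EReal) (Ps : Y → ℝ)
    (K : X →L[ℝ] Y) (xs : X) (ys : Y) : Prop where
  dom_left : G xs ≠ ⊤
  dom_right : Fs ys ≠ ⊤
  max_right : ∀ y, saddleFun G Q Fs Ps K xs y ≤ saddleFun G Q Fs Ps K xs ys
  min_left : ∀ x, saddleFun G Q Fs Ps K xs ys ≤ saddleFun G Q Fs Ps K x ys

/-- The block operator `M (x, y) = (T⁻¹ x - K* y, -K x + Σ⁻¹ y)`; `S` stands for `Σ`. -/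
def blockM (T : X ≃L[ℝ] X) (S : Y ≃L[ℝ] Y) (K : X →L[ℝ] Y) (z : X × Y) : X × Y :=
  (T.symm z.1 - ContinuousLinearMap.adjoint K z.2, -K z.1 + S.symm z.2)

/-- `‖z‖²_M = ⟨M z, z⟩` in the Hilbert space `X × Y`. -/
def normSqM (T : X ≃L[ℝ] X) (S : Y ≃L[ℝ] Y) (K : X →L[ℝ] Y) (z : X × Y) : ℝ :=
  inner ℝ (blockM T S K z).1 z.1 + inner ℝ (blockM T S K z).2 z.2

/-- The summability condition `∑_{k ≥ 1} α_k ‖(x^k, y^k) - (x^{k-1}, y^{k-1})‖²_M < ∞`. -/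
def SummabilityCondition (T : X ≃L[ℝ] X) (S : Y ≃L[ℝ] Y) (K : X →L[ℝ] Y) (α : ℕ → ℝ)
    (x : ℤ → X) (y : ℤ → Y) : Prop :=
  Summable fun k : ℕ =>
    α (k + 1) * normSqM T S K ((x (k + 1), y (k + 1)) - (x k, y k))

/-- `(x^k, y^k)`, `k = -1, 0, 1, …`, are generated by the preconditioned inertial primal-dual
forward-backward iteration, from arbitrary starting points `x^{-1}, x^0, y^{-1}, y^0`. -/
def IsInertialPDIteration (G : X → EReal) (Q : X → ℝ) (Fs : Y → EReal) (Ps : Y → ℝ)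
    (K : X →L[ℝ] Y) (T : X ≃L[ℝ] X) (S : Y ≃L[ℝ] Y) (α : ℕ → ℝ)
    (x : ℤ → X) (y : ℤ → Y) : Prop :=
  ∀ k : ℕ,
    let ξ : X := x k + α k • (x k - x (k - 1))
    let ζ : Y := y k + α k • (y k - y (k - 1))
    let ξbar : X := (2 : ℝ) • x (k + 1) - ξ
    x (k + 1) ∈ setResolvent (T : X →L[ℝ] X) (subdifferential G)
      (ξ - T (gradient Q ξ + ContinuousLinearMap.adjoint K ζ)) ∧
    y (k + 1) ∈ setResolvent (S : Y →L[ℝ] Y) (subdifferential Fs)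
      (ζ - S (gradient Ps ζ - K ξbar))

/-- The iterates `(x^k, y^k)` converge in the weak topology of `X × Y` to a saddle point. -/
def ConvergesWeaklyToSaddlePoint (G : X → EReal) (Q : X → ℝ) (Fs : Y → EReal) (Ps : Y → ℝ)
    (K : X →L[ℝ] Y) (x : ℤ → X) (y : ℤ → Y) : Prop :=
  ∃ xs ys, IsSaddlePoint G Q Fs Ps K xs ys ∧
    Tendsto (fun k : ℕ => toWeakSpace ℝ (X × Y) (x k, y k)) atTop
      (𝓝 (toWeakSpace ℝ (X × Y) (xs, ys)))

end

end InertialPD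

open InertialPD

/-!
Write `z = (x, y)`. The iteration is an inertial forward-backward step in the metric of the block
operator `M`: with `w = z^k + α_k (z^k - z^{k-1})` it reads `0 ∈ M (z^{k+1} - w) + B w + A z^{k+1}`
for the monotone `A (x, y) = (∂G x + K* y, ∂F* y - K x)` and the co-coercive `B = ∇Q × ∇P*`
(`IsForwardBackwardStep`). Let `L = D × E` and `N = M - L / 2`. For a saddle point `s`, monotonicity
of `A` and co-coercivity of `B` (completing the square, `neg_quarter_le_inner`) give
`⟨M (z^{k+1} - w), z^{k+1} - s⟩ ≤ ‖z^{k+1} - w‖_L² / 4`, and hence, for `φ_k = ‖z^k - s‖_M²`,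

`φ_{k+1} - φ_k - α_k (φ_k - φ_{k-1}) ≤ α_k (1 + α_k) ‖z^k - z^{k-1}‖_M² - ‖z^{k+1} - w‖_N²`

(`inertial_recursion`). Both claims rest on this inequality.

For the first claim, the norm condition makes `N` positive definite (`coercive_of_norm_lt_one`). As
the first term on the right is summable, the lemma of Alvarez and Attouch
(`tendsto_of_inertial_recursion`) shows that `φ_k` converges and that `z^{k+1} - w → 0`. So the
iterates are bounded, and `z^{k+1}` satisfies the inclusion `0 ∈ (A + B) z` up to a residual that
tends to zero. Written as an inequality for the primal-dual gap (`IsForwardBackwardStep.gap_le`),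
this passes to weak limits because sublevel sets of convex lower semicontinuous functions are closed
and convex (`isSaddlePoint_of_weak_limit`); no maximal monotone operators are needed. Opial's
argument then gives weak convergence. Weak cluster points are taken along ultrafilters, which avoids
the extraction of weakly convergent subsequences.

For the second claim, the conditions say that `(1 - α_k)² / 2 L ≤ (1 - 3 α_k - ε) M`
(`form_inequality_of_norm_le`). Then `N` is positive definite again
(`coercive_of_form_inequality`), and
`φ_k - α_k φ_{k-1} + 2 α_k ‖d_k‖_M² - α_k (1 - α_k) / 2 ‖d_k‖_L²` with `d_k = z^k - z^{k-1}`
decreases by at least `ε ‖d_{k+1}‖_M²` in each step, which makes `‖d_k‖_M²` summable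
(`summable_of_form_inequality`).
-/

namespace InertialPD

/-! ### Real sequences -/

section RealSequences

/-- A bound for the difference quotients on `(0, 1]` bounds the derivative at `0`. -/
theorem le_of_hasDerivAt_of_forall_sub_le {f : ℝ → ℝ} {f' c : ℝ} (hf : HasDerivAt f f' 0)
    (h : ∀ t, 0 < t → t ≤ 1 → f t - f 0 ≤ t * c) : f' ≤ c := by
  have ht := HasDerivAt.tendsto_slope_zero_right hf
  refine le_of_tendsto ht ?_
  filter_upwards [Ioc_mem_nhdsGT (zero_lt_one' ℝ)] with t ht
  have := h t ht.1 ht.2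
  rw [zero_add, smul_eq_mul, inv_mul_le_iff₀ ht.1]
  exact this

/-- Geometric damping with a summable perturbation; no sign condition on `a` is needed. -/
theorem summable_of_succ_le_mul_add {p δ : ℕ → ℝ} {a : ℝ} (hp : ∀ n, 0 ≤ p n) (hδ : Summable δ)
    (hδ0 : ∀ n, 0 ≤ δ n) (ha : a < 1) (h : ∀ n, p (n + 1) ≤ a * p n + δ n) : Summable p := by
  refine summable_of_sum_range_le (c := (p 0 + ∑' n, δ n) / (1 - a)) hp fun n => ?_
  rw [le_div_iff₀ (by linarith)]
  have key : ∀ n, ∑ i ∈ Finset.range n, p i + p n ≤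
      p 0 + a * ∑ i ∈ Finset.range n, p i + ∑ i ∈ Finset.range n, δ i := by
    intro n
    induction n with
    | zero => simp
    | succ n ih =>
      rw [Finset.sum_range_succ, Finset.sum_range_succ δ]
      have := h n
      linarith
  have h1 := key n
  have h2 := hδ.sum_le_tsum (Finset.range n) fun i _ => hδ0 i
  have h3 := hp n
  linarith

/-- A nonnegative sequence with summable positive increments converges: subtracting their partial
sums makes it antitone. -/
theorem exists_tendsto_of_sub_le_summable {φ p : ℕ → ℝ} (hφ : ∀ n, 0 ≤ φ n) (hp : Summable p)
    (hp0 : ∀ n, 0 ≤ p n) (h : ∀ n, φ (n + 1) - φ n ≤ p n) : ∃ l, Tendsto φ atTop (𝓝 l) := by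
  have hanti : Antitone fun n => φ n - ∑ i ∈ Finset.range n, p i := by
    refine antitone_nat_of_succ_le fun n => ?_
    rw [Finset.sum_range_succ]
    linarith [h n]
  have hb : BddBelow (Set.range fun n => φ n - ∑ i ∈ Finset.range n, p i) := by
    refine ⟨-∑' n, p n, ?_⟩
    rintro _ ⟨n, rfl⟩
    have := hp.sum_le_tsum (Finset.range n) fun i _ => hp0 i
    have := hφ n
    dsimp only
    linarith
  have h1 := (tendsto_atTop_ciInf hanti hb).add hp.hasSum.tendsto_sum_nat
  exact ⟨_, by simpa using h1⟩

/-- The recursion of Alvarez and Attouch for inertial methods: the positive parts of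
`φ (n + 1) - φ n` are summable, so `φ` converges, and then the recursion forces `e` to zero. -/
theorem tendsto_of_inertial_recursion {φ α δ e : ℕ → ℝ} {a : ℝ} (hφ : ∀ n, 0 ≤ φ n)
    (hα0 : ∀ n, 0 ≤ α n) (hαa : ∀ n, α n ≤ a) (ha : a < 1) (hδ : Summable δ)
    (hδ0 : ∀ n, 0 ≤ δ n) (he : ∀ n, 0 ≤ e n)
    (h : ∀ n, φ (n + 2) - φ (n + 1) - α n * (φ (n + 1) - φ n) ≤ δ n - e n) :
    (∃ l, Tendsto φ atTop (𝓝 l)) ∧ Tendsto e atTop (𝓝 0) := by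
  set p : ℕ → ℝ := fun n => max (φ (n + 1) - φ n) 0 with hpdef
  have hp0 : ∀ n, 0 ≤ p n := fun n => le_max_right _ _
  have hαp : ∀ n, α n * (φ (n + 1) - φ n) ≤ a * p n := fun n =>
    (mul_le_mul_of_nonneg_left (le_max_left _ _) (hα0 n)).trans
      (mul_le_mul_of_nonneg_right (hαa n) (hp0 n))
  have ha0 : 0 ≤ a := (hα0 0).trans (hαa 0)
  have hps : Summable p := by
    refine summable_of_succ_le_mul_add hp0 hδ hδ0 ha fun n => max_le ?_ ?_
    · linarith [h n, he n, hαp n]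
    · have := mul_nonneg ha0 (hp0 n)
      linarith [hδ0 n]
  obtain ⟨l, hl⟩ := exists_tendsto_of_sub_le_summable hφ hps hp0 fun n => le_max_left _ _
  refine ⟨⟨l, hl⟩, ?_⟩
  have hb : Tendsto (fun n => δ n + a * p n - (φ (n + 2) - φ (n + 1))) atTop (𝓝 0) := by
    have h1 := ((hδ.tendsto_atTop_zero.add (hps.tendsto_atTop_zero.const_mul a)).sub
      ((hl.comp (tendsto_add_atTop_nat 2)).sub (hl.comp (tendsto_add_atTop_nat 1))))
    simpa using h1
  refine squeeze_zero he (fun n => ?_) hb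
  linarith [h n, hαp n]

/-- A Lyapunov function `m` decreases by `ε s n` in step `n`. It need not be bounded below; the lower
bound `φ (n + 1) - a φ n` suffices, since it keeps `φ` bounded. -/
theorem summable_of_lyapunov_decrease {φ m s : ℕ → ℝ} {a ε : ℝ} (hφ : ∀ n, 0 ≤ φ n)
    (hs : ∀ n, 0 ≤ s n) (ha0 : 0 ≤ a) (ha : a < 1) (hε : 0 < ε)
    (hm : ∀ n, φ (n + 1) - a * φ n ≤ m n) (h : ∀ n, m (n + 1) ≤ m n - ε * s n) :
    Summable s := by
  have hsum : ∀ n, m n + ε * ∑ i ∈ Finset.range n, s i ≤ m 0 := by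
    intro n
    induction n with
    | zero => simp
    | succ n ih =>
      rw [Finset.sum_range_succ]
      linarith [h n]
  -- `B` satisfies `m 0 + a B ≤ B`, so the bound `φ ≤ B` is preserved
  set B : ℝ := max (φ 0) (m 0 / (1 - a)) with hB
  have hB2 : m 0 ≤ B * (1 - a) := by
    rw [← div_le_iff₀ (by linarith)]
    exact le_max_right _ _
  have hφB : ∀ n, φ n ≤ B := by
    intro n
    induction n with
    | zero => exact le_max_left _ _
    | succ n ih =>
      have h1 := hm n
      have h2 := hsum n
      have h3 := mul_nonneg hε.le (Finset.sum_nonneg fun i (_ : i ∈ Finset.range n) => hs i)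
      have h4 := mul_le_mul_of_nonneg_left ih ha0
      linarith
  refine summable_of_sum_range_le (c := (m 0 + a * B) / ε) hs fun n => ?_
  rw [le_div_iff₀ hε]
  have h1 := hm n
  have h2 := hsum n
  have h3 := mul_le_mul_of_nonneg_left (hφB n) ha0
  linarith [hφ (n + 1)]

end RealSequences

/-! ### Subdifferentials and gradients -/

section Convex

variable {H : Type*} [NormedAddCommGroup H] [InnerProductSpace ℝ H]

theorem IsProperConvexLsc.exists_eq_coe {f : H → EReal} (hf : IsProperConvexLsc f) {x : H}
    (hx : f x ≠ ⊤) : ∃ r : ℝ, f x = r :=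
  ⟨(f x).toReal, (EReal.coe_toReal hx (hf.ne_bot x)).symm⟩

theorem IsProperConvexLsc.ne_top_of_mem_subdifferential {f : H → EReal}
    (hf : IsProperConvexLsc f) {x p : H} (hp : p ∈ subdifferential f x) : f x ≠ ⊤ := by
  obtain ⟨z, hz⟩ := hf.proper
  intro hx
  have := hp z
  rw [hx, EReal.top_add_coe] at this
  exact hz (top_le_iff.1 this)

theorem subdifferential_monotone {f : H → EReal} (hf : IsProperConvexLsc f) {x x' p p' : H}
    (hp : p ∈ subdifferential f x) (hp' : p' ∈ subdifferential f x') :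
    0 ≤ inner ℝ (p - p') (x - x') := by
  obtain ⟨r, hr⟩ := hf.exists_eq_coe (hf.ne_top_of_mem_subdifferential hp)
  obtain ⟨r', hr'⟩ := hf.exists_eq_coe (hf.ne_top_of_mem_subdifferential hp')
  have h1 := hp x'
  have h2 := hp' x
  rw [hr, hr'] at h1 h2
  norm_cast at h1 h2
  simp only [inner_sub_left, inner_sub_right] at *
  linarith

variable [CompleteSpace H]

theorem hasDerivAt_comp_segment {Q : H → ℝ} (hQ : Differentiable ℝ Q) (x d : H) :
    HasDerivAt (fun t : ℝ => Q (x + t • d)) (inner ℝ (gradient Q x) d) 0 := by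
  have h1 : HasDerivAt (fun t : ℝ => x + t • d) d 0 := by
    simpa using ((hasDerivAt_id (0 : ℝ)).smul_const d).const_add x
  have h2 : HasFDerivAt Q (fderiv ℝ Q x) (x + (0 : ℝ) • d) := by
    simpa using (hQ x).hasFDerivAt
  have h3 := h2.comp_hasDerivAt (0 : ℝ) h1
  rw [← toDual_gradient, InnerProductSpace.toDual_apply_apply] at h3
  exact h3

theorem gradient_inequality {Q : H → ℝ} (hQ : ConvexOn ℝ Set.univ Q) (hQd : Differentiable ℝ Q)
    (x z : H) : Q x + inner ℝ (gradient Q x) (z - x) ≤ Q z := by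
  have := le_of_hasDerivAt_of_forall_sub_le (c := Q z - Q x)
    (hasDerivAt_comp_segment hQd x (z - x)) fun t h0 h1 => by
      have h := hQ.2 (Set.mem_univ x) (Set.mem_univ z) (sub_nonneg.2 h1) h0.le (by ring)
      have e : (1 - t) • x + t • z = x + t • (z - x) := by module
      rw [e] at h
      simp only [smul_eq_mul, zero_smul, add_zero] at h ⊢
      linarith
  linarith

/-- Fermat's rule for the sum of a convex function, a differentiable function and a linear form. -/
theorem neg_gradient_mem_subdifferential {G : H → EReal} {Q : H → ℝ} (hG : IsProperConvexLsc G)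
    (hQd : Differentiable ℝ Q) {xs c : H} (hxs : G xs ≠ ⊤)
    (h : ∀ x, G xs + (Q xs + inner ℝ c xs : ℝ) ≤ G x + (Q x + inner ℝ c x : ℝ)) :
    -(gradient Q xs + c) ∈ subdifferential G xs := by
  intro z
  by_cases hz : G z = ⊤
  · rw [hz]; exact le_top
  obtain ⟨g, hg⟩ := hG.exists_eq_coe hxs
  obtain ⟨r, hr⟩ := hG.exists_eq_coe hz
  rw [hg, hr]
  norm_cast
  have hder := (hasDerivAt_comp_segment hQd xs (z - xs)).neg
  have := le_of_hasDerivAt_of_forall_sub_le (c := r - g + inner ℝ c (z - xs)) hder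
    fun t h0 h1 => by
      have e : (1 - t) • xs + t • z = xs + t • (z - xs) := by module
      have hc := hG.convex (x := (xs, g)) (by simp [hg]) (y := (z, r)) (by simp [hr])
        (sub_nonneg.2 h1) h0.le (by ring)
      simp only [Set.mem_ofPred_eq, Prod.smul_mk, Prod.mk_add_mk, e, smul_eq_mul] at hc
      have h2 := (h (xs + t • (z - xs))).trans (add_le_add_left hc _)
      rw [hg] at h2
      norm_cast at h2
      simp only [Pi.neg_apply, zero_smul, add_zero, inner_add_right, inner_smul_right] at h2 ⊢
      linarith
  rw [inner_neg_left, inner_add_left]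
  linarith

end Convex

/-! ### Weak limits in Hilbert spaces -/

section WeakLimits

/-- A closed convex set contains the weak limits of its points. -/
theorem mem_of_weak_limit {V ι : Type*} [NormedAddCommGroup V] [NormedSpace ℝ V] {C : Set V}
    (hC : Convex ℝ C) (hCc : IsClosed C) {l : Filter ι} [l.NeBot] {z : ι → V} {zb : V}
    (hz : ∀ f : V →L[ℝ] ℝ, Tendsto (fun i => f (z i)) l (𝓝 (f zb)))
    (hmem : ∀ᶠ i in l, z i ∈ C) : zb ∈ C := by
  by_contra hzb
  obtain ⟨f, u, hu, hub⟩ := geometric_hahn_banach_closed_point hC hCc hzb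
  exact hub.not_ge (le_of_tendsto (hz f) (hmem.mono fun i hi => (hu _ hi).le))

variable {H : Type*} [NormedAddCommGroup H] [InnerProductSpace ℝ H] [CompleteSpace H]

/-- Weak compactness of balls, in terms of ultrafilters. -/
theorem exists_weak_limit {ι : Type*} (U : Ultrafilter ι) {z : ι → H} {R : ℝ}
    (hR : ∀ i, ‖z i‖ ≤ R) :
    ∃ zb : H, ∀ v, Tendsto (fun i => (inner ℝ (z i) v : ℝ)) U (𝓝 (inner ℝ zb v)) := by
  have hb : ∀ v i, |(inner ℝ (z i) v : ℝ)| ≤ R * ‖v‖ := fun v i =>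
    (abs_real_inner_le_norm _ _).trans (mul_le_mul_of_nonneg_right (hR i) (norm_nonneg v))
  have hex : ∀ v, ∃ l : ℝ, Tendsto (fun i => (inner ℝ (z i) v : ℝ)) U (𝓝 l) := by
    intro v
    obtain ⟨l, -, hl⟩ := (isCompact_Icc (a := -(R * ‖v‖)) (b := R * ‖v‖)).ultrafilter_le_nhds
      (U.map fun i => (inner ℝ (z i) v : ℝ)) (by
        rw [le_principal_iff]
        exact Ultrafilter.mem_map.2 (Filter.univ_mem' fun i => abs_le.1 (hb v i)))
    exact ⟨l, hl⟩
  choose l hl using hex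
  let L : H →ₗ[ℝ] ℝ :=
    { toFun := l
      map_add' := fun v w => tendsto_nhds_unique (hl (v + w)) (by
        simpa only [inner_add_right] using (hl v).add (hl w))
      map_smul' := fun c v => tendsto_nhds_unique (hl (c • v)) (by
        simpa only [inner_smul_right, smul_eq_mul, RingHom.id_apply] using (hl v).const_mul c) }
  let f : H →L[ℝ] ℝ := L.mkContinuous R fun v =>
    le_of_tendsto (hl v).abs (Eventually.of_forall fun i => hb v i)
  refine ⟨(InnerProductSpace.toDual ℝ H).symm f, fun v => ?_⟩
  rw [InnerProductSpace.toDual_symm_apply]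
  exact hl v

variable {X Y : Type*} [NormedAddCommGroup X] [InnerProductSpace ℝ X] [CompleteSpace X]
  [NormedAddCommGroup Y] [InnerProductSpace ℝ Y] [CompleteSpace Y]

/-- Every continuous linear form on `X × Y` is a sum of inner products with fixed vectors. -/
theorem exists_forall_prod_eq_inner (f : X × Y →L[ℝ] ℝ) :
    ∃ a b, ∀ z : X × Y, f z = inner ℝ z.1 a + inner ℝ z.2 b := by
  refine ⟨(InnerProductSpace.toDual ℝ X).symm (f.comp (ContinuousLinearMap.inl ℝ X Y)),
    (InnerProductSpace.toDual ℝ Y).symm (f.comp (ContinuousLinearMap.inr ℝ X Y)), fun z => ?_⟩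
  rw [real_inner_comm, real_inner_comm _ z.2, InnerProductSpace.toDual_symm_apply,
    InnerProductSpace.toDual_symm_apply]
  simp [← map_add]

end WeakLimits

/-! ### Sublevel sets -/

section Sublevels

variable {X Y : Type*} [NormedAddCommGroup X] [InnerProductSpace ℝ X]
  [NormedAddCommGroup Y] [InnerProductSpace ℝ Y]

/-- Addition of `EReal` is discontinuous only at `∞ - ∞`, which properness excludes. -/
theorem isClosed_sublevel {G : X → EReal} {F : Y → EReal} (hG : IsProperConvexLsc G)
    (hF : IsProperConvexLsc F) {r : X × Y → ℝ} (hr : Continuous r) (c : ℝ) :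
    IsClosed {z : X × Y | G z.1 + F z.2 + (r z : EReal) ≤ (c : EReal)} := by
  have h1 : LowerSemicontinuous fun z : X × Y => G z.1 := hG.lsc.comp continuous_fst
  have h2 : LowerSemicontinuous fun z : X × Y => F z.2 := hF.lsc.comp continuous_snd
  have h12 : LowerSemicontinuous fun z : X × Y => G z.1 + F z.2 :=
    h1.add' h2 fun z => EReal.continuousAt_add (Or.inr (hF.ne_bot _)) (Or.inl (hG.ne_bot _))
  have h3 : LowerSemicontinuous fun z : X × Y => (r z : EReal) :=
    (continuous_coe_real_ereal.comp hr).lowerSemicontinuous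
  have h := h12.add' h3 fun z => EReal.continuousAt_add (Or.inr (EReal.coe_ne_bot _))
    (Or.inr (EReal.coe_ne_top _))
  exact h.isClosed_preimage _

/-- A point of a sublevel set lies in the domains of both functions. -/
theorem exists_of_add_le_coe {G : X → EReal} {F : Y → EReal} (hG : IsProperConvexLsc G)
    (hF : IsProperConvexLsc F) {x : X} {y : Y} {r c : ℝ}
    (h : G x + F y + (r : EReal) ≤ (c : EReal)) :
    ∃ g f : ℝ, G x = g ∧ F y = f ∧ g + f + r ≤ c := by
  have hg : G x ≠ ⊤ := by
    intro hx
    rw [hx, EReal.top_add_of_ne_bot (hF.ne_bot y), EReal.top_add_coe] at h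
    exact EReal.coe_ne_top _ (top_le_iff.1 h)
  have hf : F y ≠ ⊤ := by
    intro hx
    rw [hx, EReal.add_top_of_ne_bot (hG.ne_bot x), EReal.top_add_coe] at h
    exact EReal.coe_ne_top _ (top_le_iff.1 h)
  obtain ⟨g, hg⟩ := hG.exists_eq_coe hg
  obtain ⟨f, hf⟩ := hF.exists_eq_coe hf
  refine ⟨g, f, hg, hf, ?_⟩
  rw [hg, hf] at h
  exact_mod_cast h

theorem convex_sublevel {G : X → EReal} {F : Y → EReal} (hG : IsProperConvexLsc G)
    (hF : IsProperConvexLsc F) {r : X × Y → ℝ} (hr : ConvexOn ℝ Set.univ r) (c : ℝ) :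
    Convex ℝ {z : X × Y | G z.1 + F z.2 + (r z : EReal) ≤ (c : EReal)} := by
  intro z hz w hw a b ha hb hab
  obtain ⟨g, f, hg, hf, h⟩ := exists_of_add_le_coe hG hF hz
  obtain ⟨g', f', hg', hf', h'⟩ := exists_of_add_le_coe hG hF hw
  have hgc := hG.convex (x := (z.1, g)) (by simp [hg]) (y := (w.1, g')) (by simp [hg']) ha hb hab
  have hfc := hF.convex (x := (z.2, f)) (by simp [hf]) (y := (w.2, f')) (by simp [hf']) ha hb hab
  have hrc := hr.2 (Set.mem_univ z) (Set.mem_univ w) ha hb hab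
  simp only [Set.mem_ofPred_eq, Prod.smul_mk, Prod.mk_add_mk, smul_eq_mul] at hgc hfc hrc
  have hle : G (a • z + b • w).1 + F (a • z + b • w).2 + (r (a • z + b • w) : EReal) ≤
      ((a * g + b * g' : ℝ) : EReal) + ((a * f + b * f' : ℝ) : EReal)
        + ((a * r z + b * r w : ℝ) : EReal) :=
    add_le_add (add_le_add hgc hfc) (by exact_mod_cast hrc)
  refine hle.trans ?_
  norm_cast
  have h1 := mul_le_mul_of_nonneg_left h ha
  have h2 := mul_le_mul_of_nonneg_left h' hb
  have h3 : c = a * c + b * c := by rw [← add_mul, hab, one_mul]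
  linarith

end Sublevels

/-! ### Positive operators -/

section Operators

variable {H : Type*} [NormedAddCommGroup H] [InnerProductSpace ℝ H]

/-- Symmetry of a positive operator, in the form that swaps the arguments of `⟨A u, v⟩`. -/
theorem inner_map_comm {A : H →L[ℝ] H} (hA : A.IsPositive) (u v : H) :
    (inner ℝ (A u) v : ℝ) = inner ℝ (A v) u := by
  rw [real_inner_comm u (A v)]
  exact hA.isSymmetric u v

theorem inner_symm_map_comm {A : H ≃L[ℝ] H} (hA : (A : H →L[ℝ] H).IsPositive) (u v : H) :
    (inner ℝ (A.symm u) v : ℝ) = inner ℝ (A.symm v) u := by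
  have := inner_map_comm hA (A.symm u) (A.symm v)
  simp only [ContinuousLinearEquiv.coe_coe, ContinuousLinearEquiv.apply_symm_apply] at this
  rw [real_inner_comm, ← this, real_inner_comm]

/-- `‖A u‖² ≤ ‖A‖ ⟨A u, u⟩`, from positivity of `A` at `u - ‖A‖⁻¹ A u`. -/
theorem sq_norm_map_le {A : H →L[ℝ] H} (hA : A.IsPositive) (u : H) :
    ‖A u‖ ^ 2 ≤ ‖A‖ * inner ℝ (A u) u := by
  rcases (norm_nonneg A).eq_or_lt with h0 | h0
  · have : A = 0 := norm_eq_zero.1 h0.symm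
    simp [this]
  have h1 : 0 ≤ (inner ℝ (A (u - ‖A‖⁻¹ • A u)) (u - ‖A‖⁻¹ • A u) : ℝ) := hA.inner_nonneg_left _
  have h2 : (inner ℝ (A (A u)) (A u) : ℝ) ≤ ‖A‖ * ‖A u‖ ^ 2 :=
    (real_inner_le_norm _ _).trans (by
      have := mul_le_mul_of_nonneg_right (A.le_opNorm (A u)) (norm_nonneg (A u))
      linarith)
  have h3 := inner_map_comm hA (A u) u
  simp only [map_sub, map_smul, inner_sub_left, inner_sub_right, inner_smul_left,
    inner_smul_right, RCLike.conj_to_real] at h1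
  rw [h3, real_inner_self_eq_norm_sq] at h1
  have h4 := mul_le_mul_of_nonneg_left h2 (by positivity : 0 ≤ ‖A‖⁻¹ * ‖A‖⁻¹)
  have h5 : ‖A‖⁻¹ * ‖A‖⁻¹ * (‖A‖ * ‖A u‖ ^ 2) = ‖A‖⁻¹ * ‖A u‖ ^ 2 := by field_simp
  have h6 : ‖A‖⁻¹ * ‖A u‖ ^ 2 ≤ inner ℝ (A u) u := by linarith
  rwa [inv_mul_le_iff₀ h0] at h6

/-- A positive operator with bounded inverse is bounded below. -/
theorem exists_coercive {A : H ≃L[ℝ] H} (hA : (A : H →L[ℝ] H).IsPositive) :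
    ∃ c : ℝ, 0 < c ∧ ∀ u, c * ‖u‖ ^ 2 ≤ inner ℝ (A u) u := by
  set a := ‖(A : H →L[ℝ] H)‖
  set b := ‖(A.symm : H →L[ℝ] H)‖
  refine ⟨1 / ((a + 1) * (b + 1) ^ 2), by positivity, fun u => ?_⟩
  have h1 : ‖A u‖ ^ 2 ≤ a * inner ℝ (A u) u := sq_norm_map_le hA u
  have h2 : ‖u‖ ≤ b * ‖A u‖ := by simpa using (A.symm : H →L[ℝ] H).le_opNorm (A u)
  have h0 : 0 ≤ (inner ℝ (A u) u : ℝ) := hA.inner_nonneg_left u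
  have hb : 0 ≤ b := norm_nonneg _
  have h3 : ‖u‖ ≤ (b + 1) * ‖A u‖ := h2.trans (by gcongr; linarith)
  rw [one_div, inv_mul_le_iff₀ (by positivity)]
  calc ‖u‖ ^ 2 ≤ ((b + 1) * ‖A u‖) ^ 2 := by gcongr
    _ = (b + 1) ^ 2 * ‖A u‖ ^ 2 := by ring
    _ ≤ (b + 1) ^ 2 * ((a + 1) * inner ℝ (A u) u) := by gcongr; linarith
    _ = _ := by ring

/-- Completing the square in the norm of `A⁻¹`. -/
theorem neg_quarter_le_inner {A : H ≃L[ℝ] H} (hA : (A : H →L[ℝ] H).IsPositive) (b h : H) :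
    -(1 / 4) * inner ℝ (A h) h ≤ inner ℝ (A.symm b) b + inner ℝ b h := by
  have h1 : 0 ≤ (inner ℝ (A (A.symm b + (1 / 2 : ℝ) • h)) (A.symm b + (1 / 2 : ℝ) • h) : ℝ) :=
    hA.inner_nonneg_left _
  have h2 := inner_map_comm hA h (A.symm b)
  simp only [ContinuousLinearEquiv.coe_coe, ContinuousLinearEquiv.apply_symm_apply] at h2
  simp only [map_add, map_smul, ContinuousLinearEquiv.apply_symm_apply, inner_add_left,
    inner_add_right, inner_smul_left, inner_smul_right, RCLike.conj_to_real] at h1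
  rw [real_inner_comm b (A.symm b)]
  linarith

/-- A map that is co-coercive with respect to `A⁻¹` is Lipschitz with constant `‖A‖`. -/
theorem norm_sub_le_of_isCocoerciveWrt {A : H ≃L[ℝ] H} (hA : (A : H →L[ℝ] H).IsPositive)
    {B : H → H} (hB : IsCocoerciveWrt B (A.symm : H →L[ℝ] H)) (u v : H) :
    ‖B u - B v‖ ≤ ‖(A : H →L[ℝ] H)‖ * ‖u - v‖ := by
  have h1 := hB u v
  have h2 := sq_norm_map_le hA (A.symm (B u - B v))
  simp only [ContinuousLinearEquiv.coe_coe, ContinuousLinearEquiv.apply_symm_apply] at h1 h2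
  rw [real_inner_comm] at h2
  have h3 := real_inner_le_norm (B u - B v) (u - v)
  have h4 := mul_le_mul_of_nonneg_left (h1.trans h3) (norm_nonneg (A : H →L[ℝ] H))
  rcases (norm_nonneg (B u - B v)).eq_or_lt with h0 | h0
  · rw [← h0]; positivity
  · refine le_of_mul_le_mul_right ?_ h0
    linarith

theorem IsInvSqrt.map_map_apply {A R : H →L[ℝ] H} (h : IsInvSqrt A R) (u : H) :
    R (R (A u)) = u := by
  simpa using congrArg (fun B : H →L[ℝ] H => B u) h.mul_left

/-- If `R = A^{-1/2}`, then `R A = A^{1/2}`, and `‖A^{1/2} u‖² = ⟨A u, u⟩`. -/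
theorem IsInvSqrt.sq_norm {A R : H →L[ℝ] H} (h : IsInvSqrt A R) (u : H) :
    ‖R (A u)‖ ^ 2 = inner ℝ (A u) u := by
  rw [← real_inner_self_eq_norm_sq, inner_map_comm h.pos, h.map_map_apply, real_inner_comm]

theorem IsInvSqrt.sq_norm_le {A R : H →L[ℝ] H} (h : IsInvSqrt A R) (u : H) :
    ‖u‖ ^ 2 ≤ ‖R‖ ^ 2 * inner ℝ (A u) u := by
  have h1 := R.le_opNorm (R (A u))
  rw [h.map_map_apply] at h1
  rw [← h.sq_norm, ← mul_pow]
  gcongr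

variable {X Y : Type*} [NormedAddCommGroup X] [InnerProductSpace ℝ X]
  [NormedAddCommGroup Y] [InnerProductSpace ℝ Y]

/-- A bound `r` on the norm of `A₂^{-1/2} K A₁^{-1/2}` makes the block operator with
diagonal `r A₁`, `r A₂` and off-diagonal part `-K` positive semidefinite. -/
theorem two_mul_inner_le_of_norm_comp_le {A₁ R₁ : X →L[ℝ] X} {A₂ R₂ : Y →L[ℝ] Y}
    {K : X →L[ℝ] Y} (h₁ : IsInvSqrt A₁ R₁) (h₂ : IsInvSqrt A₂ R₂) {r : ℝ}
    (hr : ‖R₂ ∘L K ∘L R₁‖ ≤ r) (x : X) (y : Y) :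
    2 * inner ℝ (K x) y ≤ r * (inner ℝ (A₁ x) x + inner ℝ (A₂ y) y) := by
  rw [← h₁.sq_norm, ← h₂.sq_norm]
  set u := R₁ (A₁ x) with hu
  set w := R₂ (A₂ y) with hw
  have e : (inner ℝ (K x) y : ℝ) = inner ℝ ((R₂ ∘L K ∘L R₁) u) w := by
    have : (inner ℝ (R₂ (K x)) w : ℝ) = inner ℝ (K x) (R₂ w) := h₂.pos.isSymmetric _ _
    simp only [ContinuousLinearMap.comp_apply]
    rw [hu, h₁.map_map_apply, this, hw, h₂.map_map_apply]
  have h1 := (real_inner_le_norm ((R₂ ∘L K ∘L R₁) u) w).trans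
    (mul_le_mul_of_nonneg_right ((R₂ ∘L K ∘L R₁).le_of_opNorm_le hr u) (norm_nonneg w))
  have hr0 : 0 ≤ r := (norm_nonneg _).trans hr
  have h2 : 0 ≤ r * (‖u‖ - ‖w‖) ^ 2 := by positivity
  rw [e]
  linarith

end Operators

variable {X Y : Type*} [NormedAddCommGroup X] [InnerProductSpace ℝ X] [CompleteSpace X]
  [NormedAddCommGroup Y] [InnerProductSpace ℝ Y] [CompleteSpace Y]

/-! ### Quadratic forms on the product space -/

section Forms

noncomputable section

/-- The bilinear form `(z, w) ↦ ⟨M z, w⟩` on `X × Y` given by the block operator `blockM`. -/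
def formM (T : X ≃L[ℝ] X) (S : Y ≃L[ℝ] Y) (K : X →L[ℝ] Y) : LinearMap.BilinForm ℝ (X × Y) :=
  LinearMap.mk₂ ℝ
    (fun z w => inner ℝ (blockM T S K z).1 w.1 + inner ℝ (blockM T S K z).2 w.2)
    (fun z z' w => by simp [blockM, inner_add_left, inner_sub_left]; ring)
    (fun c z w => by
      simp [blockM, inner_add_left, inner_sub_left, inner_smul_left]; ring)
    (fun z w w' => by simp [inner_add_right]; ring)
    (fun c z w => by simp [inner_smul_right]; ring)

/-- The bilinear form `(z, w) ↦ ⟨(D × E) z, w⟩` on `X × Y`. -/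
def formL (D : X ≃L[ℝ] X) (E : Y ≃L[ℝ] Y) : LinearMap.BilinForm ℝ (X × Y) :=
  LinearMap.mk₂ ℝ (fun z w => inner ℝ (D z.1) w.1 + inner ℝ (E z.2) w.2)
    (fun z z' w => by simp [inner_add_left]; ring)
    (fun c z w => by simp [inner_smul_left]; ring)
    (fun z w w' => by simp [inner_add_right]; ring)
    (fun c z w => by simp [inner_smul_right]; ring)

end

theorem formM_apply (T : X ≃L[ℝ] X) (S : Y ≃L[ℝ] Y) (K : X →L[ℝ] Y) (z w : X × Y) :
    formM T S K z w = inner ℝ (blockM T S K z).1 w.1 + inner ℝ (blockM T S K z).2 w.2 := rfl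

theorem formM_self (T : X ≃L[ℝ] X) (S : Y ≃L[ℝ] Y) (K : X →L[ℝ] Y) (z : X × Y) :
    formM T S K z z = normSqM T S K z := rfl

theorem formM_self_eq (T : X ≃L[ℝ] X) (S : Y ≃L[ℝ] Y) (K : X →L[ℝ] Y) (z : X × Y) :
    formM T S K z z =
      inner ℝ (T.symm z.1) z.1 + inner ℝ (S.symm z.2) z.2 - 2 * inner ℝ (K z.1) z.2 := by
  simp only [formM_apply, blockM, inner_sub_left, inner_add_left, inner_neg_left,
    ContinuousLinearMap.adjoint_inner_left]
  rw [real_inner_comm (K z.1) z.2]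
  ring

omit [CompleteSpace X] [CompleteSpace Y] in
theorem formL_apply (D : X ≃L[ℝ] X) (E : Y ≃L[ℝ] Y) (z w : X × Y) :
    formL D E z w = inner ℝ (D z.1) w.1 + inner ℝ (E z.2) w.2 := rfl

theorem formM_comm {T : X ≃L[ℝ] X} {S : Y ≃L[ℝ] Y} (K : X →L[ℝ] Y)
    (hT : (T : X →L[ℝ] X).IsPositive) (hS : (S : Y →L[ℝ] Y).IsPositive) (z w : X × Y) :
    formM T S K z w = formM T S K w z := by
  simp only [formM_apply, blockM, inner_sub_left, inner_add_left, inner_neg_left,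
    ContinuousLinearMap.adjoint_inner_left]
  rw [inner_symm_map_comm hT z.1, inner_symm_map_comm hS z.2, real_inner_comm (K w.1),
    real_inner_comm (K z.1)]
  ring

omit [CompleteSpace X] [CompleteSpace Y] in
theorem formL_comm {D : X ≃L[ℝ] X} {E : Y ≃L[ℝ] Y}
    (hD : (D : X →L[ℝ] X).IsPositive) (hE : (E : Y →L[ℝ] Y).IsPositive) (z w : X × Y) :
    formL D E z w = formL D E w z := by
  have h1 := inner_map_comm hD z.1 w.1
  have h2 := inner_map_comm hE z.2 w.2
  simp only [ContinuousLinearEquiv.coe_coe] at h1 h2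
  rw [formL_apply, formL_apply, h1, h2]

omit [CompleteSpace X] [CompleteSpace Y] in
theorem formL_self_nonneg {D : X ≃L[ℝ] X} {E : Y ≃L[ℝ] Y}
    (hD : (D : X →L[ℝ] X).IsPositive) (hE : (E : Y →L[ℝ] Y).IsPositive) (z : X × Y) :
    0 ≤ formL D E z z :=
  add_nonneg (hD.inner_nonneg_left z.1) (hE.inner_nonneg_left z.2)

/-- One inertial step from `z₋, z` to `z₊` decreases the distance to `s`, up to the terms caused by
the extrapolation `w = z + a (z - z₋)`. -/
theorem inertial_step {V : Type*} [AddCommGroup V] [Module ℝ V] {M L : LinearMap.BilinForm ℝ V}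
    (hM : ∀ u v, M u v = M v u) {a : ℝ} {zm z w zp s : V} (hw : w = z + a • (z - zm))
    (h : M (zp - w) (zp - s) ≤ 1 / 4 * L (zp - w) (zp - w)) :
    M (zp - s) (zp - s) - M (z - s) (z - s)
        - a * (M (z - s) (z - s) - M (zm - s) (zm - s)) ≤
      a * (1 + a) * M (z - zm) (z - zm)
        - (M (zp - w) (zp - w) - 1 / 2 * L (zp - w) (zp - w)) := by
  have e1 : M (zp - w) (zp - s) = 1 / 2 * (M (zp - w) (zp - w) + M (zp - s) (zp - s)
      - M (w - s) (w - s)) := by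
    have : w - s = (zp - s) - (zp - w) := by abel
    rw [this]
    generalize zp - w = p at *
    generalize zp - s = q at *
    simp only [map_sub, LinearMap.sub_apply]
    rw [hM q p]
    ring
  have e2 : M (w - s) (w - s) = (1 + a) * M (z - s) (z - s) - a * M (zm - s) (zm - s)
      + a * (1 + a) * M (z - zm) (z - zm) := by
    have h1 : w - s = (1 + a) • (z - s) - a • (zm - s) := by rw [hw]; module
    have h2 : z - zm = (z - s) - (zm - s) := by abel
    rw [h1, h2]
    generalize z - s = p
    generalize zm - s = q
    simp only [map_sub, LinearMap.sub_apply, map_smul, LinearMap.smul_apply, smul_eq_mul]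
    rw [hM q p]
    ring
  linarith

/-- `‖p - a q‖² ≥ (1 - a) ‖p‖² - a (1 - a) ‖q‖²` for a positive semidefinite form. -/
theorem form_sub_smul_ge {V : Type*} [AddCommGroup V] [Module ℝ V] {N : LinearMap.BilinForm ℝ V}
    (hN : ∀ u v, N u v = N v u) (hN0 : ∀ u, 0 ≤ N u u) {a : ℝ} (ha : 0 ≤ a) (p q : V) :
    (1 - a) * N p p - a * (1 - a) * N q q ≤ N (p - a • q) (p - a • q) := by
  have h := mul_nonneg ha (hN0 (p - q))
  simp only [map_sub, LinearMap.sub_apply, map_smul, LinearMap.smul_apply, smul_eq_mul] at h ⊢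
  rw [hN q p] at h ⊢
  linarith

end Forms

/-! ### Characterizations of saddle points -/

section SaddlePoints

variable {G : X → EReal} {Q : X → ℝ} {Fs : Y → EReal} {Ps : Y → ℝ} {K : X →L[ℝ] Y}

/-- The optimality conditions of a saddle point. -/
theorem IsSaddlePoint.mem_subdifferential (hG : IsProperConvexLsc G) (hFs : IsProperConvexLsc Fs)
    (hQd : Differentiable ℝ Q) (hPsd : Differentiable ℝ Ps) {xs : X} {ys : Y}
    (h : IsSaddlePoint G Q Fs Ps K xs ys) :
    -(gradient Q xs + ContinuousLinearMap.adjoint K ys) ∈ subdifferential G xs ∧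
      -(gradient Ps ys + -K xs) ∈ subdifferential Fs ys := by
  obtain ⟨g, hg⟩ := hG.exists_eq_coe h.dom_left
  obtain ⟨f, hf⟩ := hFs.exists_eq_coe h.dom_right
  constructor
  · refine neg_gradient_mem_subdifferential hG hQd h.dom_left fun x => ?_
    by_cases hx : G x = ⊤
    · rw [hx, EReal.top_add_coe]; exact le_top
    obtain ⟨r, hr⟩ := hG.exists_eq_coe hx
    have := h.min_left x
    simp only [saddleFun, hg, hf, hr] at this
    simp only [hg, hr, ContinuousLinearMap.adjoint_inner_left]
    norm_cast at this ⊢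
    rw [real_inner_comm, real_inner_comm _ ys]
    linarith
  · refine neg_gradient_mem_subdifferential hFs hPsd h.dom_right fun y => ?_
    by_cases hy : Fs y = ⊤
    · rw [hy, EReal.top_add_coe]; exact le_top
    obtain ⟨r, hr⟩ := hFs.exists_eq_coe hy
    have := h.max_right y
    simp only [saddleFun, hg, hf, hr] at this
    simp only [hf, hr, inner_neg_left]
    norm_cast at this ⊢
    linarith

omit [CompleteSpace X] [CompleteSpace Y] in
/-- A point satisfying the primal-dual gap inequality against all points of finite value is
a saddle point. -/
theorem isSaddlePoint_of_gap_nonpos (hG : IsProperConvexLsc G) (hFs : IsProperConvexLsc Fs)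
    {xb : X} {yb : Y}
    (h : ∀ x y (g f : ℝ), G x = g → Fs y = f →
      G xb + Fs yb + ((Q xb + Ps yb - inner ℝ (K x) yb + inner ℝ (K xb) y : ℝ) : EReal) ≤
        ((g + f + Q x + Ps y : ℝ) : EReal)) :
    IsSaddlePoint G Q Fs Ps K xb yb := by
  obtain ⟨x₀, hx₀⟩ := hG.proper
  obtain ⟨y₀, hy₀⟩ := hFs.proper
  obtain ⟨g₀, hg₀⟩ := hG.exists_eq_coe hx₀
  obtain ⟨f₀, hf₀⟩ := hFs.exists_eq_coe hy₀
  obtain ⟨g, f, hg, hf, -⟩ := exists_of_add_le_coe hG hFs (h x₀ y₀ g₀ f₀ hg₀ hf₀)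
  refine ⟨by simp [hg], by simp [hf], fun y => ?_, fun x => ?_⟩
  · by_cases hy : Fs y = ⊤
    · have : saddleFun G Q Fs Ps K xb y = ⊥ := by
        simp only [saddleFun, hg, hy]
        norm_cast
      rw [this]
      exact bot_le
    · obtain ⟨r, hr⟩ := hFs.exists_eq_coe hy
      have := h xb y g r hg hr
      simp only [saddleFun, hg, hf, hr] at this ⊢
      norm_cast at this ⊢
      linarith
  · by_cases hx : G x = ⊤
    · have : saddleFun G Q Fs Ps K x yb = ⊤ := by
        simp only [saddleFun, hf, hx]
        rw [EReal.top_add_coe, EReal.top_add_coe, EReal.top_sub_coe, EReal.top_sub_coe]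
      rw [this]
      exact le_top
    · obtain ⟨r, hr⟩ := hG.exists_eq_coe hx
      have := h x yb r f hr hf
      simp only [saddleFun, hg, hf, hr] at this ⊢
      norm_cast at this ⊢
      linarith

end SaddlePoints

/-! ### The forward-backward step -/

section Step

variable {G : X → EReal} {Q : X → ℝ} {Fs : Y → EReal} {Ps : Y → ℝ} {K : X →L[ℝ] Y}
  {T D : X ≃L[ℝ] X} {S E : Y ≃L[ℝ] Y}

omit [CompleteSpace X] in
theorem symm_sub_sub_mem_of_mem_setResolvent {A : X → Set X} {x u c : X}
    (h : x ∈ setResolvent (T : X →L[ℝ] X) A (u - T c)) : T.symm (u - x) - c ∈ A x := by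
  obtain ⟨p, hp, e⟩ := h
  have : p = T.symm (u - x) - c := by
    apply T.injective
    simp only [ContinuousLinearEquiv.coe_coe] at e
    rw [map_sub, T.apply_symm_apply]
    rw [sub_right_comm, ← e]
    abel
  rwa [← this]

/-- The step of the iteration from the extrapolated point `w` to `z`, in the form
`0 ∈ M (z - w) + (∇Q × ∇P*) w + A z` with `A (x, y) = (∂G x + K* y, ∂F* y - K x)`. -/
def IsForwardBackwardStep (G : X → EReal) (Q : X → ℝ) (Fs : Y → EReal) (Ps : Y → ℝ)
    (K : X →L[ℝ] Y) (T : X ≃L[ℝ] X) (S : Y ≃L[ℝ] Y) (w z : X × Y) : Prop :=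
  -(blockM T S K (z - w)).1 - gradient Q w.1 - ContinuousLinearMap.adjoint K z.2
      ∈ subdifferential G z.1 ∧
    -(blockM T S K (z - w)).2 - gradient Ps w.2 + K z.1 ∈ subdifferential Fs z.2

theorem IsInertialPDIteration.isForwardBackwardStep {α : ℕ → ℝ} {x : ℤ → X} {y : ℤ → Y}
    (hxy : IsInertialPDIteration G Q Fs Ps K T S α x y) (k : ℕ) :
    IsForwardBackwardStep G Q Fs Ps K T S
      ((x k, y k) + α k • ((x k, y k) - (x (k - 1), y (k - 1)))) (x (k + 1), y (k + 1)) := by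
  obtain ⟨h1, h2⟩ := hxy k
  have h1 := symm_sub_sub_mem_of_mem_setResolvent h1
  have h2 := symm_sub_sub_mem_of_mem_setResolvent h2
  constructor
  · convert h1 using 1
    simp only [blockM, Prod.fst_add, Prod.snd_add, Prod.fst_sub, Prod.snd_sub, Prod.smul_fst,
      Prod.smul_snd, map_sub, map_add, map_smul]
    abel
  · convert h2 using 1
    simp only [blockM, Prod.fst_add, Prod.snd_add, Prod.fst_sub, Prod.snd_sub, Prod.smul_fst,
      Prod.smul_snd, map_sub, map_add, map_smul, two_smul]
    abel

/-- Monotonicity of the subdifferentials and co-coercivity of the gradients, tested at a saddle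
point; the skew part `(K* y, -K x)` cancels. -/
theorem IsForwardBackwardStep.formM_le (hG : IsProperConvexLsc G) (hFs : IsProperConvexLsc Fs)
    (hQd : Differentiable ℝ Q) (hPsd : Differentiable ℝ Ps)
    (hD : (D : X →L[ℝ] X).IsPositive) (hE : (E : Y →L[ℝ] Y).IsPositive)
    (hQcoc : IsCocoerciveWrt (gradient Q) (D.symm : X →L[ℝ] X))
    (hPscoc : IsCocoerciveWrt (gradient Ps) (E.symm : Y →L[ℝ] Y))
    {w z s : X × Y} (h : IsForwardBackwardStep G Q Fs Ps K T S w z)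
    (hs : IsSaddlePoint G Q Fs Ps K s.1 s.2) :
    formM T S K (z - w) (z - s) ≤ 1 / 4 * formL D E (z - w) (z - w) := by
  obtain ⟨hs1, hs2⟩ := hs.mem_subdifferential hG hFs hQd hPsd
  have h1 := subdifferential_monotone hG h.1 hs1
  have h2 := subdifferential_monotone hFs h.2 hs2
  have h3 := hQcoc w.1 s.1
  have h4 := hPscoc w.2 s.2
  have h5 := neg_quarter_le_inner hD (gradient Q w.1 - gradient Q s.1) (z - w).1
  have h6 := neg_quarter_le_inner hE (gradient Ps w.2 - gradient Ps s.2) (z - w).2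
  simp only [ContinuousLinearEquiv.coe_coe] at h3 h4
  have e1 : (inner ℝ (ContinuousLinearMap.adjoint K (z.2 - s.2)) (z.1 - s.1) : ℝ) =
      inner ℝ (K (z.1 - s.1)) (z.2 - s.2) := by
    rw [ContinuousLinearMap.adjoint_inner_left, real_inner_comm]
  have e2 : -(blockM T S K (z - w)).1 - gradient Q w.1 - ContinuousLinearMap.adjoint K z.2
        - -(gradient Q s.1 + ContinuousLinearMap.adjoint K s.2) =
      -(blockM T S K (z - w)).1 - (gradient Q w.1 - gradient Q s.1)
        - ContinuousLinearMap.adjoint K (z.2 - s.2) := by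
    rw [map_sub]; abel
  have e3 : -(blockM T S K (z - w)).2 - gradient Ps w.2 + K z.1 - -(gradient Ps s.2 + -K s.1) =
      -(blockM T S K (z - w)).2 - (gradient Ps w.2 - gradient Ps s.2) + K (z.1 - s.1) := by
    rw [map_sub]; abel
  have e4 : z.1 - s.1 = (w.1 - s.1) + (z - w).1 := by rw [Prod.fst_sub]; abel
  have e5 : z.2 - s.2 = (w.2 - s.2) + (z - w).2 := by rw [Prod.snd_sub]; abel
  have e6 : (inner ℝ (gradient Q w.1 - gradient Q s.1) (z.1 - s.1) : ℝ) =
      inner ℝ (gradient Q w.1 - gradient Q s.1) (w.1 - s.1)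
        + inner ℝ (gradient Q w.1 - gradient Q s.1) (z - w).1 := by rw [e4, inner_add_right]
  have e7 : (inner ℝ (gradient Ps w.2 - gradient Ps s.2) (z.2 - s.2) : ℝ) =
      inner ℝ (gradient Ps w.2 - gradient Ps s.2) (w.2 - s.2)
        + inner ℝ (gradient Ps w.2 - gradient Ps s.2) (z - w).2 := by rw [e5, inner_add_right]
  rw [e2, inner_sub_left, inner_sub_left, inner_neg_left, e1, e6] at h1
  rw [e3, inner_add_left, inner_sub_left, inner_neg_left, e7] at h2
  rw [formM_apply, formL_apply]
  have e8 : (z - s).1 = z.1 - s.1 := rfl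
  have e9 : (z - s).2 = z.2 - s.2 := rfl
  rw [e8, e9]
  linarith

/-- The residual of a forward-backward step: it lies in the image of `z` under the monotone
operator of the saddle point problem. -/
noncomputable def residual (Q : X → ℝ) (Ps : Y → ℝ) (K : X →L[ℝ] Y) (T : X ≃L[ℝ] X)
    (S : Y ≃L[ℝ] Y) (w z : X × Y) : X × Y :=
  (gradient Q z.1 - gradient Q w.1 - (blockM T S K (z - w)).1,
    gradient Ps z.2 - gradient Ps w.2 - (blockM T S K (z - w)).2)

/-- The subgradient inequalities at the end point of a step, added up: the primal-dual gap against
`(x, y)` is bounded by a pairing with the residual. -/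
theorem IsForwardBackwardStep.gap_le (hG : IsProperConvexLsc G) (hFs : IsProperConvexLsc Fs)
    (hQ : ConvexOn ℝ Set.univ Q) (hPs : ConvexOn ℝ Set.univ Ps)
    (hQd : Differentiable ℝ Q) (hPsd : Differentiable ℝ Ps) {w z : X × Y}
    (h : IsForwardBackwardStep G Q Fs Ps K T S w z) {x : X} {y : Y} {g f : ℝ}
    (hx : G x = g) (hy : Fs y = f) :
    G z.1 + Fs z.2 + ((Q z.1 + Ps z.2 - inner ℝ (K x) z.2 + inner ℝ (K z.1) y : ℝ) : EReal) ≤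
      ((g + f + Q x + Ps y + inner ℝ (residual Q Ps K T S w z).1 (z.1 - x)
        + inner ℝ (residual Q Ps K T S w z).2 (z.2 - y) : ℝ) : EReal) := by
  obtain ⟨g', hg'⟩ := hG.exists_eq_coe (hG.ne_top_of_mem_subdifferential h.1)
  obtain ⟨f', hf'⟩ := hFs.exists_eq_coe (hFs.ne_top_of_mem_subdifferential h.2)
  have h1 := h.1 x
  have h2 := h.2 y
  have h3 := gradient_inequality hQ hQd z.1 x
  have h4 := gradient_inequality hPs hPsd z.2 y
  rw [hg', hx] at h1
  rw [hf', hy] at h2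
  rw [hg', hf']
  norm_cast at h1 h2 ⊢
  have e1 : ∀ u v, (inner ℝ (ContinuousLinearMap.adjoint K u) v : ℝ) = inner ℝ (K v) u :=
    fun u v => by rw [ContinuousLinearMap.adjoint_inner_left, real_inner_comm]
  simp only [residual, inner_sub_left, inner_sub_right, inner_add_left, inner_neg_left, e1]
    at h1 h2 h3 h4 ⊢
  linarith

end Step

variable {G : X → EReal} {Q : X → ℝ} {Fs : Y → EReal} {Ps : Y → ℝ} {K : X →L[ℝ] Y}
  {T D : X ≃L[ℝ] X} {S E : Y ≃L[ℝ] Y} {z : ℕ → X × Y} {a : ℕ → ℝ} {amax : ℝ}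

/-! ### Weak convergence -/

section Convergence

omit [InnerProductSpace ℝ X] [CompleteSpace X] [InnerProductSpace ℝ Y] [CompleteSpace Y] in
/-- `X × Y` carries the maximum norm, while the quadratic forms are compared with the sum of
squares. -/
theorem prod_norm_le_sqrt {c b : ℝ} (hc : 0 < c) {u : X × Y}
    (h : c * (‖u.1‖ ^ 2 + ‖u.2‖ ^ 2) ≤ b) : ‖u‖ ≤ √(c⁻¹ * b) := by
  rw [← le_inv_mul_iff₀ hc] at h
  rw [Prod.norm_def]
  refine max_le (Real.le_sqrt_of_sq_le ?_) (Real.le_sqrt_of_sq_le ?_)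
  · linarith [sq_nonneg ‖u.2‖]
  · linarith [sq_nonneg ‖u.1‖]

omit [CompleteSpace X] [CompleteSpace Y] in
theorem tendsto_zero_of_coercive {N : LinearMap.BilinForm ℝ (X × Y)} {c : ℝ} (hc : 0 < c)
    (hN : ∀ z : X × Y, c * (‖z.1‖ ^ 2 + ‖z.2‖ ^ 2) ≤ N z z) {h : ℕ → X × Y}
    (hh : Tendsto (fun n => N (h n) (h n)) atTop (𝓝 0)) : Tendsto h atTop (𝓝 0) := by
  have h1 : Tendsto (fun n => √(c⁻¹ * N (h n) (h n))) atTop (𝓝 0) := by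
    simpa using (hh.const_mul c⁻¹).sqrt
  exact squeeze_zero_norm (fun n => prod_norm_le_sqrt hc (hN (h n))) h1

theorem continuous_blockM : Continuous (blockM T S K) := by
  unfold blockM
  fun_prop

theorem tendsto_residual
    (hD : (D : X →L[ℝ] X).IsPositive) (hE : (E : Y →L[ℝ] Y).IsPositive)
    (hQcoc : IsCocoerciveWrt (gradient Q) (D.symm : X →L[ℝ] X))
    (hPscoc : IsCocoerciveWrt (gradient Ps) (E.symm : Y →L[ℝ] Y)) {w v : ℕ → X × Y}
    (h : Tendsto (fun n => v n - w n) atTop (𝓝 0)) :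
    Tendsto (fun n => residual Q Ps K T S (w n) (v n)) atTop (𝓝 0) := by
  have hb : Tendsto (fun n => blockM T S K (v n - w n)) atTop (𝓝 0) := by
    have := ((continuous_blockM (T := T) (S := S) (K := K)).tendsto 0).comp h
    have h0 : blockM T S K 0 = 0 := by simp [blockM]
    rwa [h0] at this
  have h1 : Tendsto (fun n => gradient Q (v n).1 - gradient Q (w n).1) atTop (𝓝 0) := by
    refine squeeze_zero_norm (fun n => norm_sub_le_of_isCocoerciveWrt hD hQcoc _ _) ?_
    have := ((continuous_fst.tendsto _).comp h).norm.const_mul ‖(D : X →L[ℝ] X)‖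
    simpa using this
  have h2 : Tendsto (fun n => gradient Ps (v n).2 - gradient Ps (w n).2) atTop (𝓝 0) := by
    refine squeeze_zero_norm (fun n => norm_sub_le_of_isCocoerciveWrt hE hPscoc _ _) ?_
    have := ((continuous_snd.tendsto _).comp h).norm.const_mul ‖(E : Y →L[ℝ] Y)‖
    simpa using this
  have := (h1.prodMk_nhds h2).sub hb
  rwa [← Prod.zero_eq_mk, sub_zero] at this

/-- Weak limits of forward-backward steps whose increments tend to zero are saddle points. -/
theorem isSaddlePoint_of_weak_limit (hG : IsProperConvexLsc G) (hFs : IsProperConvexLsc Fs)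
    (hQ : ConvexOn ℝ Set.univ Q) (hPs : ConvexOn ℝ Set.univ Ps)
    (hQd : Differentiable ℝ Q) (hPsd : Differentiable ℝ Ps) {w v : ℕ → X × Y}
    (hstep : ∀ n, IsForwardBackwardStep G Q Fs Ps K T S (w n) (v n)) {R : ℝ}
    (hR : ∀ n, ‖v n‖ ≤ R)
    (hres : Tendsto (fun n => residual Q Ps K T S (w n) (v n)) atTop (𝓝 0))
    {U : Filter ℕ} [U.NeBot] (hU : U ≤ atTop) {zb : X × Y}
    (hzb : ∀ f : X × Y →L[ℝ] ℝ, Tendsto (fun n => f (v n)) U (𝓝 (f zb))) :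
    IsSaddlePoint G Q Fs Ps K zb.1 zb.2 := by
  refine isSaddlePoint_of_gap_nonpos hG hFs fun x y g f hx hy => ?_
  set r : X × Y → ℝ := fun z => Q z.1 + Ps z.2 - inner ℝ (K x) z.2 + inner ℝ (K z.1) y with hr
  set c : ℝ := g + f + Q x + Ps y with hc
  have hrc : Continuous r := by
    have h1 := hQd.continuous
    have h2 := hPsd.continuous
    fun_prop
  have hrconv : ConvexOn ℝ Set.univ r := by
    refine ⟨convex_univ, fun u _ v _ s t hs ht hst => ?_⟩
    have h1 := hQ.2 (Set.mem_univ u.1) (Set.mem_univ v.1) hs ht hst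
    have h2 := hPs.2 (Set.mem_univ u.2) (Set.mem_univ v.2) hs ht hst
    simp only [hr, Prod.fst_add, Prod.snd_add, Prod.smul_fst, Prod.smul_snd, map_add, map_smul,
      inner_add_left, inner_add_right, inner_smul_left, inner_smul_right, smul_eq_mul,
      RCLike.conj_to_real] at h1 h2 ⊢
    linarith
  have herr : Tendsto (fun n => (inner ℝ (residual Q Ps K T S (w n) (v n)).1 ((v n).1 - x) : ℝ)
      + inner ℝ (residual Q Ps K T S (w n) (v n)).2 ((v n).2 - y)) atTop (𝓝 0) := by
    have hn : Tendsto (fun n => ‖residual Q Ps K T S (w n) (v n)‖ * (R + ‖x‖)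
        + ‖residual Q Ps K T S (w n) (v n)‖ * (R + ‖y‖)) atTop (𝓝 0) := by
      simpa using (hres.norm.mul_const (R + ‖x‖)).add (hres.norm.mul_const (R + ‖y‖))
    refine squeeze_zero_norm (fun n => (norm_add_le _ _).trans (add_le_add ?_ ?_)) hn
    · refine (norm_inner_le_norm _ _).trans (mul_le_mul (norm_fst_le _) ?_ (norm_nonneg _)
        (norm_nonneg _))
      exact (norm_sub_le _ _).trans (add_le_add_left ((norm_fst_le _).trans (hR n)) _)
    · refine (norm_inner_le_norm _ _).trans (mul_le_mul (norm_snd_le _) ?_ (norm_nonneg _)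
        (norm_nonneg _))
      exact (norm_sub_le _ _).trans (add_le_add_left ((norm_snd_le _).trans (hR n)) _)
  have hη : ∀ η : ℝ, 0 < η → G zb.1 + Fs zb.2 + (r zb : EReal) ≤ ((c + η : ℝ) : EReal) := by
    intro η hη
    refine mem_of_weak_limit (convex_sublevel hG hFs hrconv (c + η))
      (isClosed_sublevel hG hFs hrc (c + η)) hzb (hU ?_)
    filter_upwards [herr.eventually_lt_const hη] with n hn
    refine ((hstep n).gap_le hG hFs hQ hPs hQd hPsd hx hy).trans ?_
    norm_cast
    linarith
  obtain ⟨g', f', hg', hf', -⟩ := exists_of_add_le_coe hG hFs (hη 1 one_pos)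
  rw [hg', hf'] at hη ⊢
  norm_cast at hη ⊢
  exact le_of_forall_pos_le_add hη

/-- The fundamental recursion for the distance of the iterates to a saddle point. -/
theorem inertial_recursion (hG : IsProperConvexLsc G) (hFs : IsProperConvexLsc Fs)
    (hQd : Differentiable ℝ Q) (hPsd : Differentiable ℝ Ps)
    (hT : (T : X →L[ℝ] X).IsPositive) (hS : (S : Y →L[ℝ] Y).IsPositive)
    (hD : (D : X →L[ℝ] X).IsPositive) (hE : (E : Y →L[ℝ] Y).IsPositive)
    (hQcoc : IsCocoerciveWrt (gradient Q) (D.symm : X →L[ℝ] X))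
    (hPscoc : IsCocoerciveWrt (gradient Ps) (E.symm : Y →L[ℝ] Y))
    (hstep : ∀ n, IsForwardBackwardStep G Q Fs Ps K T S
      (z (n + 1) + a n • (z (n + 1) - z n)) (z (n + 2)))
    {s : X × Y} (hs : IsSaddlePoint G Q Fs Ps K s.1 s.2) (n : ℕ) :
    formM T S K (z (n + 2) - s) (z (n + 2) - s) - formM T S K (z (n + 1) - s) (z (n + 1) - s)
        - a n * (formM T S K (z (n + 1) - s) (z (n + 1) - s)
          - formM T S K (z n - s) (z n - s)) ≤
      a n * (1 + a n) * formM T S K (z (n + 1) - z n) (z (n + 1) - z n)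
        - (formM T S K - (1 / 2 : ℝ) • formL D E)
          (z (n + 2) - (z (n + 1) + a n • (z (n + 1) - z n)))
          (z (n + 2) - (z (n + 1) + a n • (z (n + 1) - z n))) := by
  have := inertial_step (L := formL D E) (formM_comm K hT hS) (a := a n) (zm := z n)
    (z := z (n + 1)) (zp := z (n + 2)) (s := s) rfl
    ((hstep n).formM_le hG hFs hQd hPsd hD hE hQcoc hPscoc hs)
  simpa only [LinearMap.sub_apply, LinearMap.smul_apply, smul_eq_mul] using this

/-- Weak convergence when `N = M - (D × E) / 2` is positive definite and the increments are
summable. -/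
theorem convergesWeakly_of_summable (hG : IsProperConvexLsc G) (hFs : IsProperConvexLsc Fs)
    (hQ : ConvexOn ℝ Set.univ Q) (hPs : ConvexOn ℝ Set.univ Ps)
    (hQd : Differentiable ℝ Q) (hPsd : Differentiable ℝ Ps)
    (hsol : ∃ xs ys, IsSaddlePoint G Q Fs Ps K xs ys)
    (hT : (T : X →L[ℝ] X).IsPositive) (hS : (S : Y →L[ℝ] Y).IsPositive)
    (hD : (D : X →L[ℝ] X).IsPositive) (hE : (E : Y →L[ℝ] Y).IsPositive)
    (hQcoc : IsCocoerciveWrt (gradient Q) (D.symm : X →L[ℝ] X))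
    (hPscoc : IsCocoerciveWrt (gradient Ps) (E.symm : Y →L[ℝ] Y))
    (ha0 : ∀ n, 0 ≤ a n) (hamax : ∀ n, a n ≤ amax) (hamax1 : amax < 1)
    (hstep : ∀ n, IsForwardBackwardStep G Q Fs Ps K T S
      (z (n + 1) + a n • (z (n + 1) - z n)) (z (n + 2)))
    {c : ℝ} (hc : 0 < c) (hN : ∀ z : X × Y, c * (‖z.1‖ ^ 2 + ‖z.2‖ ^ 2) ≤
      (formM T S K - (1 / 2 : ℝ) • formL D E) z z)
    (hsum : Summable fun n => a n * formM T S K (z (n + 1) - z n) (z (n + 1) - z n)) :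
    ∃ zb : X × Y, IsSaddlePoint G Q Fs Ps K zb.1 zb.2 ∧
      ∀ f : X × Y →L[ℝ] ℝ, Tendsto (fun n => f (z n)) atTop (𝓝 (f zb)) := by
  set M := formM T S K with hMdef
  have hMsymm : ∀ u v, M u v = M v u := formM_comm K hT hS
  have hM : ∀ u : X × Y, c * (‖u.1‖ ^ 2 + ‖u.2‖ ^ 2) ≤ M u u := fun u => by
    have h1 := hN u
    have h2 := formL_self_nonneg hD hE u
    simp only [LinearMap.sub_apply, LinearMap.smul_apply, smul_eq_mul] at h1
    linarith
  have hM0 : ∀ u, 0 ≤ M u u := fun u => le_trans (by positivity) (hM u)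
  have hN0 : ∀ u, 0 ≤ (M - (1 / 2 : ℝ) • formL D E) u u := fun u =>
    le_trans (by positivity) (hN u)
  have hδ0 : ∀ n, 0 ≤ a n * (1 + a n) * M (z (n + 1) - z n) (z (n + 1) - z n) := fun n => by
    have := ha0 n
    have := hM0 (z (n + 1) - z n)
    positivity
  have hδ : Summable fun n => a n * (1 + a n) * M (z (n + 1) - z n) (z (n + 1) - z n) := by
    refine Summable.of_nonneg_of_le hδ0 (fun n => ?_) (hsum.mul_left 2)
    have h1 := mul_nonneg (ha0 n) (hM0 (z (n + 1) - z n))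
    have h2 : 1 + a n ≤ 2 := by linarith [hamax n]
    nlinarith
  -- the `M`-distance to every saddle point converges
  have key : ∀ s : X × Y, IsSaddlePoint G Q Fs Ps K s.1 s.2 → _ := fun s hs =>
    tendsto_of_inertial_recursion (φ := fun n => M (z n - s) (z n - s)) (fun n => hM0 _) ha0 hamax
      hamax1 hδ hδ0 (fun n => hN0 _)
      (inertial_recursion hG hFs hQd hPsd hT hS hD hE hQcoc hPscoc hstep hs)
  obtain ⟨xs, ys, hs⟩ := hsol
  obtain ⟨⟨l, hl⟩, he⟩ := key (xs, ys) hs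
  have hres := tendsto_residual (K := K) (T := T) (S := S) hD hE hQcoc hPscoc
    (tendsto_zero_of_coercive hc hN he)
  obtain ⟨R, hR⟩ : ∃ R, ∀ n, ‖z n‖ ≤ R := by
    obtain ⟨B, hB⟩ := hl.bddAbove_range
    refine ⟨√(c⁻¹ * B) + ‖(xs, ys)‖, fun n => ?_⟩
    have h1 : M (z n - (xs, ys)) (z n - (xs, ys)) ≤ B := hB ⟨n, rfl⟩
    have h3 : ‖z n - (xs, ys)‖ ≤ √(c⁻¹ * B) := prod_norm_le_sqrt hc ((hM _).trans h1)
    have h4 := norm_add_le (z n - (xs, ys)) (xs, ys)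
    rw [sub_add_cancel] at h4
    linarith
  have hlim : ∀ U : Ultrafilter ℕ, (U : Filter ℕ) ≤ atTop → ∃ zb : X × Y,
      IsSaddlePoint G Q Fs Ps K zb.1 zb.2 ∧
        ∀ f : X × Y →L[ℝ] ℝ, Tendsto (fun n => f (z (n + 2))) U (𝓝 (f zb)) := by
    intro U hU
    obtain ⟨xb, hxb⟩ := exists_weak_limit U (z := fun n => (z (n + 2)).1)
      fun n => (norm_fst_le _).trans (hR (n + 2))
    obtain ⟨yb, hyb⟩ := exists_weak_limit U (z := fun n => (z (n + 2)).2)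
      fun n => (norm_snd_le _).trans (hR (n + 2))
    have hf : ∀ f : X × Y →L[ℝ] ℝ, Tendsto (fun n => f (z (n + 2))) U (𝓝 (f (xb, yb))) := by
      intro f
      obtain ⟨p, q, hpq⟩ := exists_forall_prod_eq_inner f
      simp only [hpq]
      exact (hxb p).add (hyb q)
    exact ⟨(xb, yb), isSaddlePoint_of_weak_limit hG hFs hQ hPs hQd hPsd hstep
      (fun n => hR (n + 2)) hres hU hf, hf⟩
  -- Opial's argument: all weak cluster points coincide
  have huniq : ∀ (U V : Ultrafilter ℕ), (U : Filter ℕ) ≤ atTop → (V : Filter ℕ) ≤ atTop →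
      ∀ u v : X × Y, IsSaddlePoint G Q Fs Ps K u.1 u.2 → IsSaddlePoint G Q Fs Ps K v.1 v.2 →
      (∀ f : X × Y →L[ℝ] ℝ, Tendsto (fun n => f (z (n + 2))) U (𝓝 (f u))) →
      (∀ f : X × Y →L[ℝ] ℝ, Tendsto (fun n => f (z (n + 2))) V (𝓝 (f v))) → u = v := by
    intro U V hU hV u v hu hv hUu hVv
    obtain ⟨⟨p, hp⟩, -⟩ := key u hu
    obtain ⟨⟨q, hq⟩, -⟩ := key v hv
    have hcont : Continuous (M (u - v)) := by
      simp only [hMdef, formM]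
      change Continuous fun w : X × Y => (inner ℝ (blockM T S K (u - v)).1 w.1 : ℝ)
        + inner ℝ (blockM T S K (u - v)).2 w.2
      fun_prop
    let f : X × Y →L[ℝ] ℝ := ⟨M (u - v), hcont⟩
    have hf : Tendsto (fun n => f (z (n + 2))) atTop
        (𝓝 ((q - p + (M u u - M v v)) / 2)) := by
      refine (((((hq.sub hp).add_const (M u u - M v v)).div_const 2).comp
        (tendsto_add_atTop_nat 2)).congr fun n => ?_)
      change _ = M (u - v) (z (n + 2))
      simp only [Function.comp_apply, map_sub, LinearMap.sub_apply]
      rw [hMsymm (z (n + 2)) u, hMsymm (z (n + 2)) v]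
      ring
    have h1 : M (u - v) u = M (u - v) v :=
      (tendsto_nhds_unique (hUu f) (hf.mono_left hU)).trans
        (tendsto_nhds_unique (hVv f) (hf.mono_left hV)).symm
    have h2 : M (u - v) (u - v) = 0 := by rw [map_sub (M (u - v)), h1, sub_self]
    have h3 := hM (u - v)
    rw [h2] at h3
    have h4 := prod_norm_le_sqrt hc h3
    rw [mul_zero, Real.sqrt_zero] at h4
    exact sub_eq_zero.1 (norm_le_zero_iff.1 h4)
  obtain ⟨zb, hzb, hzbf⟩ := hlim (Ultrafilter.of atTop) (Ultrafilter.of_le atTop)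
  refine ⟨zb, hzb, fun f => ?_⟩
  rw [← tendsto_add_atTop_iff_nat 2, tendsto_iff_ultrafilter]
  intro U hU
  obtain ⟨u, hu, huf⟩ := hlim U hU
  rw [huniq _ U (Ultrafilter.of_le atTop) hU zb u hzb hu hzbf huf]
  exact huf f

end Convergence

/-! ### Summability of the increments -/

section Summability

/-- The second set of step size conditions, as an inequality of quadratic forms, implies
summability. -/
theorem summable_of_form_inequality (hG : IsProperConvexLsc G) (hFs : IsProperConvexLsc Fs)
    (hQd : Differentiable ℝ Q) (hPsd : Differentiable ℝ Ps)
    (hsol : ∃ xs ys, IsSaddlePoint G Q Fs Ps K xs ys)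
    (hT : (T : X →L[ℝ] X).IsPositive) (hS : (S : Y →L[ℝ] Y).IsPositive)
    (hD : (D : X →L[ℝ] X).IsPositive) (hE : (E : Y →L[ℝ] Y).IsPositive)
    (hQcoc : IsCocoerciveWrt (gradient Q) (D.symm : X →L[ℝ] X))
    (hPscoc : IsCocoerciveWrt (gradient Ps) (E.symm : Y →L[ℝ] Y))
    (hamono : Monotone a) (ha0 : ∀ n, 0 ≤ a n) (hamax : ∀ n, a n ≤ amax) (hamax1 : amax < 1)
    (hstep : ∀ n, IsForwardBackwardStep G Q Fs Ps K T S
      (z (n + 1) + a n • (z (n + 1) - z n)) (z (n + 2)))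
    (hN0 : ∀ u : X × Y, 0 ≤ (formM T S K - (1 / 2 : ℝ) • formL D E) u u)
    {ε : ℝ} (hε : 0 < ε) (hML : ∀ n (u : X × Y),
      (1 - a n) ^ 2 / 2 * formL D E u u ≤ (1 - 3 * a n - ε) * formM T S K u u) :
    Summable fun n => a n * formM T S K (z (n + 1) - z n) (z (n + 1) - z n) := by
  obtain ⟨xs, ys, hs⟩ := hsol
  have hrec := inertial_recursion (s := (xs, ys)) hG hFs hQd hPsd hT hS hD hE hQcoc hPscoc hstep hs
  set M := formM T S K with hMdef
  set L := formL D E with hLdef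
  set N := M - (1 / 2 : ℝ) • L with hNdef
  have hNeq : ∀ u, N u u = M u u - 1 / 2 * L u u := fun u => by
    simp only [hNdef, LinearMap.sub_apply, LinearMap.smul_apply, smul_eq_mul]
  have hNsymm : ∀ u v, N u v = N v u := fun u v => by
    simp only [hNdef, LinearMap.sub_apply, LinearMap.smul_apply, hMdef, hLdef]
    rw [formM_comm K hT hS, formL_comm hD hE]
  have hM0 : ∀ u, 0 ≤ M u u := fun u => by
    linarith [hNeq u, hN0 u, formL_self_nonneg hD hE u]
  have hlyap : Summable fun n => M (z (n + 2) - z (n + 1)) (z (n + 2) - z (n + 1)) := by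
    -- the terms in the increments are `a (1 + a) M + a (1 - a) N`, the ones which the recursion leaves
    refine summable_of_lyapunov_decrease (φ := fun n => M (z n - (xs, ys)) (z n - (xs, ys)))
      (m := fun n => M (z (n + 1) - (xs, ys)) (z (n + 1) - (xs, ys))
        - a n * M (z n - (xs, ys)) (z n - (xs, ys))
        + 2 * a n * M (z (n + 1) - z n) (z (n + 1) - z n)
        - a n * (1 - a n) / 2 * L (z (n + 1) - z n) (z (n + 1) - z n))
      (a := amax) (ε := ε) (fun n => hM0 _) (fun n => hM0 _) ((ha0 0).trans (hamax 0)) hamax1 hε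
      (fun n => ?_) (fun n => ?_)
    · have h1 := mul_le_mul_of_nonneg_right (hamax n) (hM0 (z n - (xs, ys)))
      have h2 : 0 ≤ a n * (1 + a n) * M (z (n + 1) - z n) (z (n + 1) - z n) :=
        mul_nonneg (mul_nonneg (ha0 n) (by linarith [ha0 n])) (hM0 _)
      have h3 : 0 ≤ a n * (1 - a n) * N (z (n + 1) - z n) (z (n + 1) - z n) :=
        mul_nonneg (mul_nonneg (ha0 n) (by linarith [hamax n])) (hN0 _)
      rw [hNeq] at h3
      linarith
    · have h1 := hrec n
      have e : z (n + 2) - (z (n + 1) + a n • (z (n + 1) - z n)) =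
          (z (n + 2) - z (n + 1)) - a n • (z (n + 1) - z n) := by abel
      rw [e] at h1
      have h2 := form_sub_smul_ge hNsymm hN0 (ha0 n) (z (n + 2) - z (n + 1)) (z (n + 1) - z n)
      have h3 := hML (n + 1) (z (n + 2) - z (n + 1))
      have hmon : 0 ≤ a (n + 1) - a n := sub_nonneg.2 (hamono n.le_succ)
      have h4 := mul_nonneg hmon (hM0 (z (n + 1) - (xs, ys)))
      have h5 := mul_nonneg hmon (hN0 (z (n + 2) - z (n + 1)))
      rw [hNeq, hNeq] at h2
      rw [hNeq] at h5
      have e2 : n + 1 + 1 = n + 2 := rfl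
      rw [e2]
      linarith
  refine (summable_nat_add_iff 1).1 (Summable.of_nonneg_of_le
    (fun n => mul_nonneg (ha0 _) (hM0 _)) (fun n => ?_) hlyap)
  exact mul_le_of_le_one_left (hM0 _) ((hamax _).trans hamax1.le)

end Summability

/-! ### Positivity from the step size conditions -/

section StepSizes

/-- The condition `‖A₂^{-1/2} K A₁^{-1/2}‖ < 1` makes `M - (D × E) / 2` positive definite. -/
theorem coercive_of_norm_lt_one {R₁ : X →L[ℝ] X} {R₂ : Y →L[ℝ] Y}
    (h₂ : IsInvSqrt ((S.symm : Y →L[ℝ] Y) - (1 / 2 : ℝ) • (E : Y →L[ℝ] Y)) R₂)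
    (h₁ : IsInvSqrt ((T.symm : X →L[ℝ] X) - (1 / 2 : ℝ) • (D : X →L[ℝ] X)) R₁)
    (hlt : ‖R₂ ∘L K ∘L R₁‖ < 1) :
    ∃ c : ℝ, 0 < c ∧ ∀ z : X × Y, c * (‖z.1‖ ^ 2 + ‖z.2‖ ^ 2) ≤
      (formM T S K - (1 / 2 : ℝ) • formL D E) z z := by
  set r := ‖R₂ ∘L K ∘L R₁‖
  have hr : 0 < 1 - r := by linarith
  refine ⟨(1 - r) / (‖R₁‖ ^ 2 + ‖R₂‖ ^ 2 + 1), by positivity, fun z => ?_⟩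
  have h := two_mul_inner_le_of_norm_comp_le h₁ h₂ (le_refl r) z.1 z.2
  have hx := h₁.sq_norm_le z.1
  have hy := h₂.sq_norm_le z.2
  have hx0 := (sq_nonneg _).trans (h₁.sq_norm z.1).le
  have hy0 := (sq_nonneg _).trans (h₂.sq_norm z.2).le
  have e : (formM T S K - (1 / 2 : ℝ) • formL D E) z z =
      inner ℝ (((T.symm : X →L[ℝ] X) - (1 / 2 : ℝ) • (D : X →L[ℝ] X)) z.1) z.1
      + inner ℝ (((S.symm : Y →L[ℝ] Y) - (1 / 2 : ℝ) • (E : Y →L[ℝ] Y)) z.2) z.2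
      - 2 * inner ℝ (K z.1) z.2 := by
    rw [LinearMap.sub_apply, LinearMap.sub_apply, LinearMap.smul_apply, LinearMap.smul_apply,
      formM_self_eq, formL_apply]
    simp [inner_sub_left, inner_smul_left]
    ring
  rw [e]
  generalize (inner ℝ (((T.symm : X →L[ℝ] X) - (1 / 2 : ℝ) • (D : X →L[ℝ] X)) z.1) z.1 : ℝ) = p
    at *
  generalize (inner ℝ (((S.symm : Y →L[ℝ] Y) - (1 / 2 : ℝ) • (E : Y →L[ℝ] Y)) z.2) z.2 : ℝ) = q
    at *
  have h1 : ‖z.1‖ ^ 2 + ‖z.2‖ ^ 2 ≤ (‖R₁‖ ^ 2 + ‖R₂‖ ^ 2 + 1) * (p + q) := by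
    have := mul_nonneg (sq_nonneg ‖R₁‖) hy0
    have := mul_nonneg (sq_nonneg ‖R₂‖) hx0
    linarith
  calc _ ≤ (1 - r) / (‖R₁‖ ^ 2 + ‖R₂‖ ^ 2 + 1) * ((‖R₁‖ ^ 2 + ‖R₂‖ ^ 2 + 1) * (p + q)) := by
        gcongr
    _ = (1 - r) * (p + q) := by field_simp
    _ ≤ _ := by linarith

/-- In the presence of a nonzero vector, `δ A⁻¹ - q D` can only be positive and invertible if
`δ > 0`. -/
theorem pos_of_isInvSqrt {H : Type*} [NormedAddCommGroup H] [InnerProductSpace ℝ H]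
    {A B : H ≃L[ℝ] H} (hA : (A : H →L[ℝ] H).IsPositive) (hB : (B : H →L[ℝ] H).IsPositive)
    {δ q : ℝ} (hq : 0 ≤ q) {R : H →L[ℝ] H}
    (h : IsInvSqrt (δ • (A.symm : H →L[ℝ] H) - q • (B : H →L[ℝ] H)) R) {u : H} (hu : u ≠ 0) :
    0 < δ := by
  have h1 := h.sq_norm_le u
  have h2 : 0 ≤ (inner ℝ (B u) u : ℝ) := hB.inner_nonneg_left u
  have h3 : 0 ≤ (inner ℝ (A.symm u) u : ℝ) := by
    have := hA.inner_nonneg_right (A.symm u)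
    simpa using this
  simp only [sub_apply, smul_apply, inner_sub_left,
    inner_smul_left, RCLike.conj_to_real, ContinuousLinearEquiv.coe_coe] at h1
  by_contra hδ
  have h4 := mul_nonneg (neg_nonneg.2 (not_lt.1 hδ)) h3
  have h5 := mul_nonneg hq h2
  have h6 : 0 < ‖u‖ ^ 2 := by positivity
  have h7 := mul_nonneg (sq_nonneg ‖R‖) (add_nonneg h4 h5)
  linarith

/-- The norm bound `1 / δ` makes `δ M - q (D × E)` positive semidefinite, because the off-diagonal
part of this block operator is `-δ K`. -/
theorem form_inequality_of_norm_le {δ q : ℝ} (hδ : 0 < δ) {R₁ : X →L[ℝ] X} {R₂ : Y →L[ℝ] Y}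
    (h₂ : IsInvSqrt (δ • (S.symm : Y →L[ℝ] Y) - q • (E : Y →L[ℝ] Y)) R₂)
    (h₁ : IsInvSqrt (δ • (T.symm : X →L[ℝ] X) - q • (D : X →L[ℝ] X)) R₁)
    (hle : ‖R₂ ∘L K ∘L R₁‖ ≤ 1 / δ) (u : X × Y) :
    q * formL D E u u ≤ δ * formM T S K u u := by
  have h := mul_le_mul_of_nonneg_left (two_mul_inner_le_of_norm_comp_le h₁ h₂ hle u.1 u.2) hδ.le
  rw [← mul_assoc δ (1 / δ), mul_one_div_cancel hδ.ne', one_mul] at h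
  simp only [sub_apply, smul_apply, inner_sub_left,
    inner_smul_left, RCLike.conj_to_real, ContinuousLinearEquiv.coe_coe] at h
  rw [formM_self_eq, formL_apply]
  linarith

/-- The second set of step size conditions makes `M - (D × E) / 2` positive definite. -/
theorem coercive_of_form_inequality
    (hD : (D : X →L[ℝ] X).IsPositive) (hE : (E : Y →L[ℝ] Y).IsPositive) {a ε : ℝ} (ha0 : 0 ≤ a)
    (ha1 : a < 1) (hε : 0 < ε) (hδ : 0 < 1 - 3 * a - ε)
    (hML : ∀ u : X × Y,
      (1 - a) ^ 2 / 2 * formL D E u u ≤ (1 - 3 * a - ε) * formM T S K u u) :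
    ∃ c : ℝ, 0 < c ∧ ∀ z : X × Y, c * (‖z.1‖ ^ 2 + ‖z.2‖ ^ 2) ≤
      (formM T S K - (1 / 2 : ℝ) • formL D E) z z := by
  obtain ⟨d, hd, hDd⟩ := exists_coercive hD
  obtain ⟨e, he, hEe⟩ := exists_coercive hE
  have ha2 : 0 < (1 - a) ^ 2 := by have : 0 < 1 - a := by linarith
                                   positivity
  have hL : ∀ z : X × Y, min d e * (‖z.1‖ ^ 2 + ‖z.2‖ ^ 2) ≤ formL D E z z := fun z => by
    rw [formL_apply, mul_add]
    refine add_le_add (le_trans ?_ (hDd z.1)) (le_trans ?_ (hEe z.2))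
    · gcongr; exact min_le_left _ _
    · gcongr; exact min_le_right _ _
  -- `M ≥ (1 - a)² / (2 δ) L` with `δ = 1 - 3 a - ε`, and `(1 - a)² = δ + ε + a + a²`,
  -- so that `M - L / 2 ≥ ε / (2 δ) L`
  refine ⟨ε / (2 * (1 - 3 * a - ε)) * min d e, by positivity, fun z => ?_⟩
  have hL0 : 0 ≤ formL D E z z := le_trans (by positivity) (hL z)
  rw [LinearMap.sub_apply, LinearMap.sub_apply, LinearMap.smul_apply, LinearMap.smul_apply,
    smul_eq_mul, mul_assoc]
  refine (mul_le_mul_of_nonneg_left (hL z) (by positivity)).trans ?_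
  rw [div_mul_eq_mul_div, div_le_iff₀ (by positivity)]
  have h1 := hML z
  have h2 : 0 ≤ (a + a ^ 2) * formL D E z z := by positivity
  linarith

end StepSizes

/-! ### The iteration -/

omit [CompleteSpace X] [CompleteSpace Y] in
/-- The weak topology of `X × Y` is tested by continuous linear forms. It is Hausdorff, so the
pairing separates points, as the characterization of its limits requires. -/
theorem convergesWeaklyToSaddlePoint_of_forall {x : ℤ → X} {y : ℤ → Y} {zb : X × Y}
    (hzb : IsSaddlePoint G Q Fs Ps K zb.1 zb.2)
    (h : ∀ f : X × Y →L[ℝ] ℝ, Tendsto (fun n : ℕ => f (x n, y n)) atTop (𝓝 (f zb))) :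
    ConvergesWeaklyToSaddlePoint G Q Fs Ps K x y := by
  refine ⟨zb.1, zb.2, hzb, ?_⟩
  refine (WeakBilin.tendsto_iff_forall_eval_tendsto _
    (fun u v huv => ?_)).2 fun f => h f
  by_contra hne
  obtain ⟨f, hf⟩ := SeparatingDual.exists_separating_of_ne (R := ℝ) hne
  exact hf (LinearMap.congr_fun huv f)

end InertialPD

theorem theorem4 {X Y : Type*}
    [NormedAddCommGroup X] [InnerProductSpace ℝ X] [CompleteSpace X]
    [NormedAddCommGroup Y] [InnerProductSpace ℝ Y] [CompleteSpace Y]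
    -- the saddle point problem
    (G : X → EReal) (Q : X → ℝ) (Fs : Y → EReal) (Ps : Y → ℝ) (K : X →L[ℝ] Y)
    (hG : IsProperConvexLsc G) (hFs : IsProperConvexLsc Fs)
    (hQ : ConvexOn ℝ Set.univ Q) (hPs : ConvexOn ℝ Set.univ Ps)
    (hQd : Differentiable ℝ Q) (hPsd : Differentiable ℝ Ps)
    (hsol : ∃ xs ys, IsSaddlePoint G Q Fs Ps K xs ys)
    -- the step size maps `T` and `Σ` (called `S`) and the maps `D`, `E`
    (T D : X ≃L[ℝ] X) (S E : Y ≃L[ℝ] Y)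
    (hT : (T : X →L[ℝ] X).IsPositive) (hS : (S : Y →L[ℝ] Y).IsPositive)
    (hD : (D : X →L[ℝ] X).IsPositive) (hE : (E : Y →L[ℝ] Y).IsPositive)
    (hQcoc : IsCocoerciveWrt (gradient Q) (D.symm : X →L[ℝ] X))
    (hPscoc : IsCocoerciveWrt (gradient Ps) (E.symm : Y →L[ℝ] Y))
    -- the extrapolation factors and the iterates
    (α : ℕ → ℝ) (αmax : ℝ) (hαmono : Monotone α) (hα0 : ∀ k, 0 ≤ α k)
    (hαle : ∀ k, α k ≤ αmax) (hαmax : αmax < 1)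
    (x : ℤ → X) (y : ℤ → Y) (hxy : IsInertialPDIteration G Q Fs Ps K T S α x y) :
    -- first claim
    (IsStrictlyPositive ((S.symm : Y →L[ℝ] Y) - (1 / 2 : ℝ) • (E : Y →L[ℝ] Y)) →
      IsStrictlyPositive ((T.symm : X →L[ℝ] X) - (1 / 2 : ℝ) • (D : X →L[ℝ] X)) →
      (∃ (R₂ : Y →L[ℝ] Y) (R₁ : X →L[ℝ] X),
        IsInvSqrt ((S.symm : Y →L[ℝ] Y) - (1 / 2 : ℝ) • (E : Y →L[ℝ] Y)) R₂ ∧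
        IsInvSqrt ((T.symm : X →L[ℝ] X) - (1 / 2 : ℝ) • (D : X →L[ℝ] X)) R₁ ∧
        ‖R₂ ∘L K ∘L R₁‖ < 1) →
      SummabilityCondition T S K α x y →
      ConvergesWeaklyToSaddlePoint G Q Fs Ps K x y) ∧
    -- second claim
    ((∃ ε : ℝ, 0 < ε ∧ ∀ k,
        ((1 - α k) ^ 2 / 2) • (E : Y →L[ℝ] Y)
          ≤ (1 - 3 * α k - ε) • (S.symm : Y →L[ℝ] Y) ∧
        ((1 - α k) ^ 2 / 2) • (D : X →L[ℝ] X)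
          ≤ (1 - 3 * α k - ε) • (T.symm : X →L[ℝ] X) ∧
        ∃ (R₂ : Y →L[ℝ] Y) (R₁ : X →L[ℝ] X),
          IsInvSqrt ((1 - 3 * α k - ε) • (S.symm : Y →L[ℝ] Y)
            - ((1 - α k) ^ 2 / 2) • (E : Y →L[ℝ] Y)) R₂ ∧
          IsInvSqrt ((1 - 3 * α k - ε) • (T.symm : X →L[ℝ] X)
            - ((1 - α k) ^ 2 / 2) • (D : X →L[ℝ] X)) R₁ ∧
          ‖R₂ ∘L K ∘L R₁‖ ≤ 1 / (1 - 3 * α k - ε)) →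
      SummabilityCondition T S K α x y ∧
      ConvergesWeaklyToSaddlePoint G Q Fs Ps K x y) := by
  -- the iterates as a sequence indexed by `ℕ`, the recursion starting from the second step
  have hstep : ∀ n : ℕ, IsForwardBackwardStep G Q Fs Ps K T S
      ((x (n + 1 : ℕ), y (n + 1 : ℕ)) + α (n + 1) •
        ((x (n + 1 : ℕ), y (n + 1 : ℕ)) - (x (n : ℕ), y (n : ℕ))))
      (x (n + 2 : ℕ), y (n + 2 : ℕ)) := by
    intro n
    have h := hxy.isForwardBackwardStep (n + 1)
    have e1 : ((n + 1 : ℕ) : ℤ) - 1 = (n : ℕ) := by push_cast; ring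
    have e2 : ((n + 1 : ℕ) : ℤ) + 1 = (n + 2 : ℕ) := by push_cast; ring
    rw [e1, e2] at h
    exact h
  have hsumm : SummabilityCondition T S K α x y ↔ Summable fun n : ℕ => α (n + 1) *
      formM T S K ((x (n + 1 : ℕ), y (n + 1 : ℕ)) - (x (n : ℕ), y (n : ℕ)))
        ((x (n + 1 : ℕ), y (n + 1 : ℕ)) - (x (n : ℕ), y (n : ℕ))) := by
    simp only [SummabilityCondition, formM_self, Nat.cast_add, Nat.cast_one]
  have conv : (∃ c : ℝ, 0 < c ∧ ∀ z : X × Y, c * (‖z.1‖ ^ 2 + ‖z.2‖ ^ 2) ≤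
      (formM T S K - (1 / 2 : ℝ) • formL D E) z z) → SummabilityCondition T S K α x y →
      ConvergesWeaklyToSaddlePoint G Q Fs Ps K x y := by
    rintro ⟨c, hc, hN⟩ hsum
    obtain ⟨zb, hzb, hf⟩ := convergesWeakly_of_summable (z := fun n : ℕ => (x n, y n))
      (a := fun n => α (n + 1)) hG hFs hQ hPs hQd hPsd hsol hT hS hD hE hQcoc hPscoc
      (fun n => hα0 _) (fun n => hαle _) hαmax hstep hc hN (hsumm.1 hsum)
    exact convergesWeaklyToSaddlePoint_of_forall hzb hf
  refine ⟨fun _ _ ⟨R₂, R₁, h₂, h₁, hlt⟩ hsum =>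
    conv (coercive_of_norm_lt_one h₂ h₁ hlt) hsum, ?_⟩
  rintro ⟨ε, hε, hk⟩
  by_cases htriv : Subsingleton X ∧ Subsingleton Y
  · -- here the condition does not force `1 - 3 α - ε > 0`, but there is only one point
    obtain ⟨hX, hY⟩ := htriv
    obtain ⟨xs, ys, hs⟩ := hsol
    refine ⟨hsumm.2 ?_, xs, ys, hs, ?_⟩
    · have h0 : ∀ u : X × Y, formM T S K u u = 0 := fun u => by
        rw [Subsingleton.elim u 0, map_zero]
      simp only [h0, mul_zero]
      exact summable_zero
    · have h0 : ∀ k : ℕ, (x k, y k) = (xs, ys) := fun k => Subsingleton.elim _ _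
      simp only [h0]
      exact tendsto_const_nhds
  have hδ : ∀ k, 0 < 1 - 3 * α k - ε := by
    intro k
    obtain ⟨-, -, R₂, R₁, h₂, h₁, -⟩ := hk k
    rw [not_and_or, not_subsingleton_iff_nontrivial, not_subsingleton_iff_nontrivial] at htriv
    rcases htriv with h | h
    · obtain ⟨u, hu⟩ := exists_ne (0 : X)
      exact pos_of_isInvSqrt hT hD (by positivity) h₁ hu
    · obtain ⟨u, hu⟩ := exists_ne (0 : Y)
      exact pos_of_isInvSqrt hS hE (by positivity) h₂ hu
  have hML : ∀ k (u : X × Y),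
      (1 - α k) ^ 2 / 2 * formL D E u u ≤ (1 - 3 * α k - ε) * formM T S K u u := by
    intro k u
    obtain ⟨-, -, R₂, R₁, h₂, h₁, hle⟩ := hk k
    exact form_inequality_of_norm_le (hδ k) h₂ h₁ hle u
  have hcoer := coercive_of_form_inequality hD hE (hα0 0) ((hαle 0).trans_lt hαmax) hε (hδ 0)
    (hML 0)
  have hsum : SummabilityCondition T S K α x y := by
    obtain ⟨c, hc, hN⟩ := hcoer
    exact hsumm.2 (summable_of_form_inequality (z := fun n : ℕ => (x n, y n))
      (a := fun n => α (n + 1)) hG hFs hQd hPsd hsol hT hS hD hE hQcoc hPscoc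
      (fun m n hmn => hαmono (Nat.succ_le_succ hmn)) (fun n => hα0 _) (fun n => hαle _) hαmax hstep
      (fun u => le_trans (by positivity) (hN u)) hε fun n => hML (n + 1))
  exact ⟨hsum, conv hcoer hsum⟩
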